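/- There are a deterministic multi-stack Turing machine $M$ and constants $C, k$ such that the following holds for every finite directed graph $G=(V,E)$ with positive integer edge capacities $w(e)$ $(e \in E\subseteq V\times V)$, a designated source $s\in V$ and a designated sink $t\in V$, $s\neq t$. Let $n=|V|$ and let $W$ be the maximum capacity of an edge of $G$ (with the convention $\log W = 0$ if $G$ has no edge). An $(s,t)$-cut is a set $A\subseteq V$ with $s\in A$, $t\notin A$; its capacity is the sum of the capacities of the edges leaving $A$; an $(s,t)$-mincut is an $(s,t)$-cut of least capacity. Every vertex $v$ of $G$ can be assigned a binary label $\ell(v)$ of at most $C(\log^2 n+\log n\log W)$ bits such that, for every edge $e=(x,y)\in E$ and every integer $\Delta\ge -w(e)$, the machine $M$, given only $\ell(x)$, $\ell(y)$ and $\Delta$ (in binary), outputs in binary the capacity of the $(s,t)$-mincut of the graph obtained from $G$ by changing the capacity of $e$ from $w(e)$ to $w(e)+\Delta$, and it does so within $C\big((\log n+\log W)^k+\log(|\Delta|+1)\big)$ steps, that is, in time polylogarithmic in $n$ and $W$, plus time linear in the number of bits of $\Delta$. -/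

import Mathlib

/-- A finite directed weighted graph on the vertex set `V`: a set of directed edges (ordered pairs),
each carrying a positive integer capacity. -/
structure WeightedDigraph (V : Type*) where
  /-- the directed edges -/
  edges : Finset (V × V)
  /-- the capacity of an edge (the value on pairs that are not edges is never used) -/
  weight : V × V → ℕ
  /-- every edge has positive capacity -/
  weight_pos : ∀ e ∈ edges, 0 < weight e

/-- The capacity of `C`: the sum of the capacities `w e` of all edges of `E` that leave `C`. -/
def cutCapacity {V : Type*} [DecidableEq V] (E : Finset (V × V)) (w : V × V → ℕ)
    (C : Finset V) : ℕ :=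
  ∑ e ∈ E with e.1 ∈ C ∧ e.2 ∉ C, w e

/-- The capacity of an `(s,t)`-mincut: the least capacity of a set of vertices that contains `s`
and does not contain `t`. -/
noncomputable def minCutCapacity {V : Type*} [DecidableEq V] (E : Finset (V × V))
    (w : V × V → ℕ) (s t : V) : ℕ :=
  sInf {c | ∃ C : Finset V, s ∈ C ∧ t ∉ C ∧ cutCapacity E w C = c}

/-- For `s ≠ t` the infimum above is a minimum. -/
theorem minCutCapacity_isLeast {V : Type*} [DecidableEq V] (E : Finset (V × V))
    (w : V × V → ℕ) {s t : V} (h : s ≠ t) :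
    IsLeast {c | ∃ C : Finset V, s ∈ C ∧ t ∉ C ∧ cutCapacity E w C = c}
      (minCutCapacity E w s t) :=
  ⟨Nat.sInf_mem ⟨_, {s}, by simp, by simpa using h.symm, rfl⟩, fun _ hc => Nat.sInf_le hc⟩

namespace WeightedDigraph

variable {V : Type*}

/-- The maximum capacity of an edge (`0` if there is no edge). -/
def maxWeight (G : WeightedDigraph V) : ℕ :=
  G.edges.sup G.weight

/-- The capacities after the capacity of `e` has been changed to `weight e + Δ`, where
`-(weight e) ≤ Δ`, so that the new capacity is a natural number. -/
def changedWeight [DecidableEq V] (G : WeightedDigraph V) (e : V × V) (Δ : ℤ) : V × V → ℕ :=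
  Function.update G.weight e ((G.weight e : ℤ) + Δ).toNat

end WeightedDigraph

/-- An integer written as a bit string: its sign bit, followed by the binary digits of its
absolute value, least significant digit first. -/
def intBits (z : ℤ) : List Bool :=
  decide (z < 0) :: z.natAbs.bits

/-- The input of a query: the two labels and the change of capacity, separated by the symbol
`none`. -/
def queryInput (a b : List Bool) (Δ : ℤ) : List (Option Bool) :=
  a.map some ++ none :: (b.map some ++ none :: (intBits Δ).map some)

/-- The machine `M`, started on `input`, halts with `output` after at most `T` steps. -/
def HaltsWithin {Γ₀ Γ₁ : Type} (M : Turing.TM2ComputableAux Γ₀ Γ₁) (input : List Γ₀)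
    (output : List Γ₁) (T : ℝ) : Prop :=
  ∃ m : ℕ, (m : ℝ) ≤ T ∧
    Nonempty (Turing.TM2OutputsInTime M.tm (input.map M.inputAlphabet.symm)
      (some (output.map M.outputAlphabet.symm)) m)

/-!
A cut of the changed graph either is left by the changed edge `e = (x, y)`, and then its capacity
changes by `Δ`, or it is not, and keeps its capacity. So the new mincut has capacity
`min (β, α + Δ)`, where `α` and `β` are the least capacities of a cut that `e` leaves and of a cut
that `e` does not leave.

The number `β` splits over the two vertices: a cut that `e` does not leave avoids `x` or contains
`y`, so `β` is the minimum of a number of `x` and a number of `y`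
(`WeightedDigraph.avoidCap`, `WeightedDigraph.containCap`).

The number `α` matters only if `e` is vital, that is, if removing `e` decreases the mincut. By
uncrossing, no vital edge enters the mincut of another vital edge
(`WeightedDigraph.IsMinCross.not_enters`). Hence, in the list of the mincuts for vital edges, sorted
by capacity, the first cut that separates `x` from `y` in either direction is a mincut for `e` if
`e` is vital. Ordering the vertices lexicographically by this list puts them on a line, on which the
capacity of the first separating cut is a distance with `μ i j = min (μ i m) (μ m j)` for `m`
between `i` and `j`; vital edges point forward on this line, and for any other edge the distance is
either too large to matter or not used (`WeightedDigraph.exists_line`,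
`WeightedDigraph.minCutCapacity_changedWeight`).

Such a distance has short labels: for every dyadic interval that contains its position, a vertex
stores the bit that tells the half, and its distance to the middle. Two positions are separated by
the middle at the first level where their bits differ (`firstDiff_lineBlocks`). There are
`O(log n)` levels, with numbers of `O(log n + log W)` bits.

The machine scans the two labels in parallel and takes digitwise minima from the most significant
digit on, adds `Δ` from the least significant digit on, and takes the minimum with `β` while it
writes the output. It makes linearly many steps (`queryMachine_run`).
-/

/-! ### Binary numbers and digitwise minimum -/

/-- The natural number with the binary digits `l`, least significant digit first. -/
def bitsVal : List Bool → ℕ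
  | [] => 0
  | b :: l => b.toNat + 2 * bitsVal l

/-- The natural number with the binary digits `l`, most significant digit first. -/
def bitsValMSB : List Bool → ℕ
  | [] => 0
  | b :: l => b.toNat * 2 ^ l.length + bitsValMSB l

theorem bitsValMSB_lt (l : List Bool) : bitsValMSB l < 2 ^ l.length := by
  induction l with
  | nil => simp [bitsValMSB]
  | cons b l ih =>
    have := Bool.toNat_le b
    simp only [bitsValMSB, List.length_cons, pow_succ]
    nlinarith

theorem bitsVal_append (l m : List Bool) :
    bitsVal (l ++ m) = bitsVal l + 2 ^ l.length * bitsVal m := by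
  induction l with
  | nil => simp [bitsVal]
  | cons b l ih => simp only [List.cons_append, bitsVal, ih, List.length_cons, pow_succ]; ring

theorem bitsVal_reverse (l : List Bool) : bitsVal l.reverse = bitsValMSB l := by
  induction l with
  | nil => rfl
  | cons b l ih => simp [bitsVal_append, ih, bitsValMSB, bitsVal]; ring

theorem bitsValMSB_reverse (l : List Bool) : bitsValMSB l.reverse = bitsVal l := by
  rw [← bitsVal_reverse, List.reverse_reverse]

theorem bitsVal_bits (n : ℕ) : bitsVal n.bits = n := by
  induction n using Nat.binaryRec' with
  | zero => simp [bitsVal]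
  | bit b n h ih =>
    rw [Nat.bits_append_bit _ _ h, bitsVal, ih, Nat.bit_val]; ring

/-- The `B` lowest binary digits of `v`, most significant digit first. -/
def digitsMSB : ℕ → ℕ → List Bool
  | 0, _ => []
  | B + 1, v => v.testBit B :: digitsMSB B v

@[simp] theorem length_digitsMSB (B v : ℕ) : (digitsMSB B v).length = B := by
  induction B with
  | zero => rfl
  | succ B ih => simp [digitsMSB, ih]

theorem bitsValMSB_digitsMSB {B v : ℕ} (h : v < 2 ^ B) : bitsValMSB (digitsMSB B v) = v := by
  have key : ∀ B, bitsValMSB (digitsMSB B v) = v % 2 ^ B := by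
    intro B
    induction B with
    | zero => simp [digitsMSB, bitsValMSB, Nat.mod_one]
    | succ B ih =>
      rw [digitsMSB, bitsValMSB, ih, length_digitsMSB, Nat.testBit_eq_decide_div_mod_eq,
        Nat.mod_pow_succ]
      rcases Nat.mod_two_eq_zero_or_one (v / 2 ^ B) with h | h <;> simp [h, add_comm]
  rw [key, Nat.mod_eq_of_lt h]

/-- The digit of the minimum of two numbers read in parallel from the most significant digit.
The state records which of them can still be the smaller one: `none` if the digits read so far
agree, `some false` if it is the first number, `some true` if it is the second. -/
def minDigit : Option Bool → Bool → Bool → Bool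
  | none, u, v => u && v
  | some false, u, _ => u
  | some true, _, v => v

/-- The state of the digitwise minimum after the digits `u` and `v`. -/
def minState : Option Bool → Bool → Bool → Option Bool
  | none, u, v => if u = v then none else some u
  | some b, _, _ => some b

/-- The digits of the minimum of two numbers, most significant digit first, from state `c` on. -/
def minDigits : Option Bool → List (Bool × Bool) → List Bool
  | _, [] => []
  | c, (u, v) :: l => minDigit c u v :: minDigits (minState c u v) l

@[simp] theorem length_minDigits (c : Option Bool) (l : List (Bool × Bool)) :
    (minDigits c l).length = l.length := by
  induction l generalizing c with
  | nil => rfl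
  | cons p l ih => simp [minDigits, ih]

/-- Once the comparison is decided, the digits of the smaller number are copied. -/
theorem minDigits_false (l : List (Bool × Bool)) :
    minDigits (some false) l = l.map Prod.fst := by
  induction l with
  | nil => rfl
  | cons p l ih => simp [minDigits, minState, ih, minDigit]

theorem minDigits_true (l : List (Bool × Bool)) :
    minDigits (some true) l = l.map Prod.snd := by
  induction l with
  | nil => rfl
  | cons p l ih => simp [minDigits, minState, ih, minDigit]

theorem bitsValMSB_minDigits (l : List (Bool × Bool)) :
    bitsValMSB (minDigits none l)
      = min (bitsValMSB (l.map Prod.fst)) (bitsValMSB (l.map Prod.snd)) := by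
  induction l with
  | nil => rfl
  | cons p l ih =>
    obtain ⟨u, v⟩ := p
    have h1 := bitsValMSB_lt (l.map Prod.fst)
    have h2 := bitsValMSB_lt (l.map Prod.snd)
    simp only [List.length_map] at h1 h2
    cases u <;> cases v <;>
      simp [minDigits, minDigit, minState, bitsValMSB, ih, minDigits_false,
        minDigits_true] <;> omega

/-! ### The machine -/

/-- The stacks of the query machine: the input; the labels of the first and of the second vertex;
the candidate capacity of the cuts that the changed edge leaves (`near`); the capacity of the cuts
that it does not leave (`far`); the pairs of digits of the two final candidates; the output. -/
inductive QStack
  | inp | lab₁ | lab₂ | near | far | cand | out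
  deriving DecidableEq

instance : Fintype QStack :=
  ⟨{.inp, .lab₁, .lab₂, .near, .far, .cand, .out}, fun x => by cases x <;> decide⟩

/-- The alphabets of the stacks. -/
abbrev QStack.Sym : QStack → Type
  | .inp => Option Bool
  | .cand => Bool × Bool
  | _ => Bool

/-- The program positions of the query machine. -/
inductive QLabel
  | read₁ | read₂ | sign | scan | add | final
  deriving DecidableEq

instance : Fintype QLabel :=
  ⟨{.read₁, .read₂, .sign, .scan, .add, .final}, fun x => by cases x <;> decide⟩

/-- The phases of the parallel scan of two labels: before the first header, in the block with the
capacities of the cuts that the edge does not leave, at levels where the positions agree, at the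
first level where they differ, and after it. -/
inductive Phase
  | start | far | same | active | done
  deriving DecidableEq

instance : Fintype Phase :=
  ⟨{.start, .far, .same, .active, .done}, fun x => by cases x <;> decide⟩

/-- The internal states of the query machine. -/
structure QState where
  /-- the last symbol popped from the input -/
  d : Option (Option Bool)
  /-- the control bit of the current symbol, or the last digit popped from `near` -/
  e : Option Bool
  /-- the data bit from the first label, or the last digit popped from `far` -/
  u : Option Bool
  /-- the data bit from the second label -/
  v : Option Bool
  /-- the pair of digits popped from `cand` -/
  w : Option (Bool × Bool)
  /-- the phase of the scan -/
  ph : Phase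
  /-- the state of the digitwise minimum -/
  c : Option Bool
  /-- whether every cut is left by the edge, so that the number on `far` is to be ignored -/
  inf : Bool
  /-- whether the change of capacity is negative -/
  neg : Bool
  /-- the carry or borrow -/
  cy : Bool
  /-- whether a nonzero digit has been written -/
  st : Bool

noncomputable instance : Fintype QState :=
  Fintype.ofInjective
    (fun q => ((q.d, q.e, q.u, q.v), (q.w, q.ph, q.c), (q.inf, q.neg, q.cy, q.st)))
    fun q q' h => by
      obtain ⟨⟩ := q
      obtain ⟨⟩ := q'
      simp only [Prod.mk.injEq] at h
      obtain ⟨⟨rfl, rfl, rfl, rfl⟩, ⟨rfl, rfl, rfl⟩, rfl, rfl, rfl, rfl⟩ := h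
      rfl

/-- The initial state. -/
def QState.init : QState :=
  ⟨none, none, none, none, none, .start, none, false, false, false, false⟩

/-- The phase after a header with data bits `u` and `v`. -/
def Phase.next : Phase → Bool → Bool → Phase
  | .start, _, _ => .far
  | .far, u, v => if u = v then .same else .active
  | .same, u, v => if u = v then .same else .active
  | .active, _, _ => .done
  | .done, _, _ => .done

/-- The carry (or borrow, if `neg`) of a digit position. -/
def nextCarry (neg r d c : Bool) : Bool :=
  if neg then (!r && (d || c)) || (d && c) else (r && (d || c)) || (d && c)

namespace QState

/-- The state after a header of the scan. The first header is the one that sets `inf`. -/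
def header (q : QState) : QState :=
  { q with
    ph := q.ph.next (q.u.getD false) (q.v.getD false)
    inf := bif q.ph = .start then q.u.getD false && q.v.getD false else q.inf
    c := none }

/-- The state after a pair of digits of the two numbers that are being compared. -/
def payload (q : QState) : QState :=
  { q with c := minState q.c (q.u.getD false) (q.v.getD false) }

/-- The digit of the minimum at the current pair of digits. -/
def digit (q : QState) : Bool := minDigit q.c (q.u.getD false) (q.v.getD false)

/-- The last bit popped from the input: `false` if this was a separator or the end, so that the
digits of the change of capacity are padded with zeros. -/
def dd (q : QState) : Bool := q.d.join.getD false

/-- The state with the registers of popped symbols erased. -/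
def clear (q : QState) : QState :=
  { q with d := none, e := none, u := none, v := none, w := none }

end QState

open Turing TM2.Stmt in
/-- The program of the query machine. `read₁` and `read₂` move the labels to their own stacks, which
reverses them, and `sign` reads the sign of the change of capacity; its digits, least significant
first, stay on the input stack. `scan` reads the two labels in parallel, one symbol of three bits of
each per step. `add` works from the least significant digit on, and leaves the most significant
digits on top of `cand`, which is the order in which `final` takes the minimum. -/
def queryProgram : QLabel → TM2.Stmt QStack.Sym QLabel QState
  | .read₁ =>
    pop .inp (fun q o => { q with d := o }) <|
    branch (fun q => q.d.join.isSome)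
      (push .lab₁ (fun q => q.dd) <| load .clear <| goto fun _ => .read₁)
      (load .clear <| goto fun _ => .read₂)
  | .read₂ =>
    pop .inp (fun q o => { q with d := o }) <|
    branch (fun q => q.d.join.isSome)
      (push .lab₂ (fun q => q.dd) <| load .clear <| goto fun _ => .read₂)
      (load .clear <| goto fun _ => .sign)
  | .sign =>
    pop .inp (fun q o => { q with neg := o.join.getD false }) <| goto fun _ => .scan
  | .scan =>
    pop .lab₁ (fun q o => { q with e := o }) <|
    pop .lab₁ (fun q o => { q with u := o }) <|
    pop .lab₁ (fun q _ => q) <|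
    pop .lab₂ (fun q _ => q) <|
    pop .lab₂ (fun q _ => q) <|
    pop .lab₂ (fun q o => { q with v := o }) <|
    branch (fun q => q.e.isSome)
      (branch (fun q => q.e.getD false)
        (load (.clear ∘ .header) <| goto fun _ => .scan)
        (branch (fun q => q.ph = .far)
          (push .far QState.digit <| load (.clear ∘ .payload) <| goto fun _ => .scan)
          (branch (fun q => q.ph = .active)
            (push .near QState.digit <| load (.clear ∘ .payload) <| goto fun _ => .scan)
            (load (.clear ∘ .payload) <| goto fun _ => .scan))))
      (load .clear <| goto fun _ => .add)
  | .add =>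
    pop .near (fun q o => { q with e := o }) <|
    pop .far (fun q o => { q with u := o }) <|
    pop .inp (fun q o => { q with d := o }) <|
    branch (fun q => q.e.isSome || q.u.isSome || q.d.isSome)
      (push .cand (fun q => (q.u.getD false, xor (q.e.getD false) (xor q.dd q.cy))) <|
        load (fun q => { q with cy := nextCarry q.neg (q.e.getD false) q.dd q.cy }) <|
        load .clear <| goto fun _ => .add)
      (push .cand (fun q => (false, q.cy)) <|
        load (fun q => { q with c := bif q.inf then some true else none }) <|
        load .clear <| goto fun _ => .final)
  | .final =>
    pop .cand (fun q o => { q with w := o }) <|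
    branch (fun q => q.w.isSome)
      (load (fun q => { q with u := q.w.map Prod.fst, v := q.w.map Prod.snd }) <|
        branch (fun q => q.st || q.digit)
          (push .out QState.digit <| load (fun q => { q with st := true }) <|
            load (.clear ∘ .payload) <| goto fun _ => .final)
          (load (.clear ∘ .payload) <| goto fun _ => .final))
      (load (fun _ => .init) halt)

/-- The query machine, with its stacks, alphabets and states. -/
noncomputable def queryTM : Turing.FinTM2 where
  K := QStack
  k₀ := .inp
  k₁ := .out
  Γ := QStack.Sym
  Λ := QLabel
  main := .read₁
  σ := QState
  initialState := .init
  Γk₀Fin := inferInstanceAs (Fintype (Option Bool))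
  m := queryProgram

/-- The query machine as a machine that maps words over `Option Bool` to words over `Bool`. -/
noncomputable def queryMachine : Turing.TM2ComputableAux (Option Bool) Bool where
  tm := queryTM
  inputAlphabet := Equiv.refl _
  outputAlphabet := Equiv.refl _

/-- The family of the contents of the seven stacks. -/
def tapes (i : List (Option Bool)) (a b n f : List Bool) (p : List (Bool × Bool))
    (o : List Bool) : ∀ k : QStack, List k.Sym
  | .inp => i
  | .lab₁ => a
  | .lab₂ => b
  | .near => n
  | .far => f
  | .cand => p
  | .out => o

section
variable (i i' : List (Option Bool)) (a b n f x : List Bool) (p p' : List (Bool × Bool))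
  (o : List Bool)

@[simp] theorem update_tapes_inp :
    Function.update (tapes i a b n f p o) .inp i' = tapes i' a b n f p o := by
  funext k; cases k <;> simp [tapes]
@[simp] theorem update_tapes_lab₁ :
    Function.update (tapes i a b n f p o) .lab₁ x = tapes i x b n f p o := by
  funext k; cases k <;> simp [tapes]
@[simp] theorem update_tapes_lab₂ :
    Function.update (tapes i a b n f p o) .lab₂ x = tapes i a x n f p o := by
  funext k; cases k <;> simp [tapes]
@[simp] theorem update_tapes_near :
    Function.update (tapes i a b n f p o) .near x = tapes i a b x f p o := by
  funext k; cases k <;> simp [tapes]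
@[simp] theorem update_tapes_far :
    Function.update (tapes i a b n f p o) .far x = tapes i a b n x p o := by
  funext k; cases k <;> simp [tapes]
@[simp] theorem update_tapes_cand :
    Function.update (tapes i a b n f p o) .cand p' = tapes i a b n f p' o := by
  funext k; cases k <;> simp [tapes]
@[simp] theorem update_tapes_out :
    Function.update (tapes i a b n f p o) .out x = tapes i a b n f p x := by
  funext k; cases k <;> simp [tapes]
@[simp] theorem tapes_inp : tapes i a b n f p o .inp = i := rfl
@[simp] theorem tapes_lab₁ : tapes i a b n f p o .lab₁ = a := rfl
@[simp] theorem tapes_lab₂ : tapes i a b n f p o .lab₂ = b := rfl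
@[simp] theorem tapes_near : tapes i a b n f p o .near = n := rfl
@[simp] theorem tapes_far : tapes i a b n f p o .far = f := rfl
@[simp] theorem tapes_cand : tapes i a b n f p o .cand = p := rfl
@[simp] theorem tapes_out : tapes i a b n f p o .out = o := rfl
end

/-- The configurations of the query machine. -/
abbrev QCfg := Turing.TM2.Cfg QStack.Sym QLabel QState

/-- The machine passes from `x` to `y` in at most `n` steps. -/
def RunsIn (n : ℕ) (x y : QCfg) : Prop :=
  ∃ m ≤ n, (flip bind (Turing.TM2.step queryProgram))^[m] (some x) = some y

theorem RunsIn.refl (n : ℕ) (x : QCfg) : RunsIn n x x := ⟨0, Nat.zero_le _, rfl⟩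

theorem RunsIn.trans {n m k : ℕ} {x y z : QCfg} (h : RunsIn n x y) (h' : RunsIn m y z)
    (hk : n + m ≤ k) : RunsIn k x z := by
  obtain ⟨a, ha, ea⟩ := h
  obtain ⟨b, hb, eb⟩ := h'
  exact ⟨b + a, by omega, by rw [Function.iterate_add_apply, ea, eb]⟩

theorem RunsIn.head {n : ℕ} {x y z : QCfg} (h : Turing.TM2.step queryProgram x = some y)
    (h' : RunsIn n y z) : RunsIn (n + 1) x z := by
  obtain ⟨b, hb, eb⟩ := h'
  refine ⟨b + 1, by omega, ?_⟩
  rw [Function.iterate_succ_apply]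
  change (flip bind _)^[b] (Turing.TM2.step queryProgram x) = _
  rw [h, eb]

theorem runs_read₁ (l : List Bool) (i : List (Option Bool)) (a : List Bool) :
    RunsIn (l.length + 1) ⟨some .read₁, .init, tapes (l.map some ++ none :: i) a [] [] [] [] []⟩
      ⟨some .read₂, .init, tapes i (l.reverse ++ a) [] [] [] [] []⟩ := by
  induction l generalizing a with
  | nil =>
    refine RunsIn.head ?_ (RunsIn.refl _ _)
    simp [queryProgram, QState.clear, QState.init]
  | cons b l ih =>
    refine RunsIn.head (y := ⟨some .read₁, .init,
      tapes (l.map some ++ none :: i) (b :: a) [] [] [] [] []⟩) ?_ ?_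
    · simp [queryProgram, QState.clear, QState.init, QState.dd]
    · simpa using ih (b :: a)

theorem runs_read₂ (l : List Bool) (i : List (Option Bool)) (a b : List Bool) :
    RunsIn (l.length + 1) ⟨some .read₂, .init, tapes (l.map some ++ none :: i) a b [] [] [] []⟩
      ⟨some .sign, .init, tapes i a (l.reverse ++ b) [] [] [] []⟩ := by
  induction l generalizing b with
  | nil =>
    refine RunsIn.head ?_ (RunsIn.refl _ _)
    simp [queryProgram, QState.clear, QState.init]
  | cons x l ih =>
    refine RunsIn.head (y := ⟨some .read₂, .init,
      tapes (l.map some ++ none :: i) a (x :: b) [] [] [] []⟩) ?_ ?_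
    · simp [queryProgram, QState.clear, QState.init, QState.dd]
    · simpa using ih (x :: b)

theorem runs_sign (neg : Bool) (i : List (Option Bool)) (a b : List Bool) :
    RunsIn 1 ⟨some .sign, .init, tapes (some neg :: i) a b [] [] [] []⟩
      ⟨some .scan, { QState.init with neg := neg }, tapes i a b [] [] [] []⟩ := by
  refine RunsIn.head ?_ (RunsIn.refl _ _)
  simp [queryProgram, QState.init]

/-- The part of a configuration that the scan of the labels changes: the phase, the state of the
digitwise minimum, the flag `inf`, and the stacks `near` and `far`. -/
structure ScanState where
  /-- the phase of the scan -/
  ph : Phase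
  /-- the state of the digitwise minimum -/
  c : Option Bool
  /-- whether every cut is left by the queried edge -/
  inf : Bool
  /-- the stack `near`, least significant digit on top -/
  near : List Bool
  /-- the stack `far`, least significant digit on top -/
  far : List Bool

/-- One step of the scan, on the control bit and the two data bits. -/
def ScanState.step (S : ScanState) : Bool × Bool × Bool → ScanState
  | (true, u, v) =>
    { S with ph := S.ph.next u v, c := none, inf := bif S.ph = .start then u && v else S.inf }
  | (false, u, v) =>
    { S with
      c := minState S.c u v
      near := if S.ph = .active then minDigit S.c u v :: S.near else S.near
      far := if S.ph = .far then minDigit S.c u v :: S.far else S.far }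

/-- A list of symbols, each a control bit and two data bits, written as a bit string. -/
def flatten₃ (l : List (Bool × Bool × Bool)) : List Bool :=
  l.flatMap fun s => [s.1, s.2.1, s.2.2]

theorem length_flatten₃ (l : List (Bool × Bool × Bool)) :
    (flatten₃ l).length = 3 * l.length := by
  induction l with
  | nil => rfl
  | cons s l ih =>
    simp only [flatten₃, List.flatMap_cons, List.length_append] at ih ⊢
    simp [ih]
    ring

/-- The symbols seen by the parallel scan: the control bit and the first data bit are read from
the first label, the second data bit is read from the second one. -/
def mergeSymbols (l m : List (Bool × Bool × Bool)) : List (Bool × Bool × Bool) :=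
  List.zipWith (fun s t => (s.1, s.2.1, t.2.2)) l m

/-- The state of the machine during the scan. -/
def scanQ (neg : Bool) (S : ScanState) : QState :=
  { QState.init with neg := neg, ph := S.ph, c := S.c, inf := S.inf }

theorem runs_scan (neg : Bool) (i : List (Option Bool)) (l m : List (Bool × Bool × Bool))
    (h : l.length = m.length) (S : ScanState) :
    RunsIn (l.length + 1)
      ⟨some .scan, scanQ neg S, tapes i (flatten₃ l) (flatten₃ m) S.near S.far [] []⟩
      ⟨some .add, scanQ neg ((mergeSymbols l m).foldl .step S),
        tapes i [] [] ((mergeSymbols l m).foldl .step S).near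
          ((mergeSymbols l m).foldl .step S).far [] []⟩ := by
  induction l generalizing m S with
  | nil =>
    obtain rfl : m = [] := List.length_eq_zero_iff.1 h.symm
    refine RunsIn.head ?_ (RunsIn.refl _ _)
    simp [queryProgram, QState.clear, QState.init, flatten₃, scanQ, mergeSymbols]
  | cons s l ih =>
    obtain _ | ⟨t, m⟩ := m
    · simp at h
    obtain ⟨e, u, u'⟩ := s
    obtain ⟨e', v', v⟩ := t
    refine RunsIn.head ?_ (ih m (by simpa using h) (S.step (e, u, v)))
    obtain ⟨ph, c, inf, near, far⟩ := S
    cases e <;> cases ph <;>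
      simp [queryProgram, QState.clear, QState.init, flatten₃, scanQ,
        ScanState.step, QState.header, QState.payload, QState.digit]

/-- The state of the machine during the addition, with carry `cy`. -/
def addQ (neg inf : Bool) (ph : Phase) (c : Option Bool) (cy : Bool) : QState :=
  { QState.init with neg := neg, ph := ph, c := c, inf := inf, cy := cy }

theorem step_add (neg inf : Bool) (ph : Phase) (c : Option Bool) (cy : Bool)
    (r f d : List Bool) (p : List (Bool × Bool)) (h : ¬(r = [] ∧ f = [] ∧ d = [])) :
    Turing.TM2.step queryProgram
        ⟨some .add, addQ neg inf ph c cy, tapes (d.map some) [] [] r f p []⟩ =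
      some ⟨some .add,
        addQ neg inf ph c (nextCarry neg (r.head?.getD false) (d.head?.getD false) cy),
        tapes (d.tail.map some) [] [] r.tail f.tail
          ((f.head?.getD false, xor (r.head?.getD false) (xor (d.head?.getD false) cy)) :: p)
          []⟩ := by
  rcases r with _ | ⟨r₀, r⟩ <;> rcases f with _ | ⟨f₀, f⟩ <;> rcases d with _ | ⟨d₀, d⟩ <;>
    first
    | exact absurd ⟨rfl, rfl, rfl⟩ h
    | simp [queryProgram, QState.clear, QState.init, addQ, QState.dd]

theorem bitsVal_head_tail (l : List Bool) :
    bitsVal l = (l.head?.getD false).toNat + 2 * bitsVal l.tail := by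
  cases l <;> simp [bitsVal]

theorem nextCarry_add (a b c : Bool) :
    (xor a (xor b c)).toNat + 2 * (nextCarry false a b c).toNat
      = a.toNat + b.toNat + c.toNat := by
  cases a <;> cases b <;> cases c <;> rfl

theorem nextCarry_sub (a b c : Bool) :
    (xor a (xor b c)).toNat + b.toNat + c.toNat
      = a.toNat + 2 * (nextCarry true a b c).toNat := by
  cases a <;> cases b <;> cases c <;> rfl

/-- The addition writes the digits of `near ± d` next to those of `far`. In the case of a
subtraction the result is assumed to be nonnegative. -/
theorem runs_add (neg inf : Bool) (ph : Phase) (c : Option Bool) (N : ℕ) (cy : Bool)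
    (r f d : List Bool) (p : List (Bool × Bool))
    (hr : r.length ≤ N) (hf : f.length ≤ N) (hd : d.length ≤ N)
    (hneg : neg = true → bitsVal d + cy.toNat ≤ bitsVal r) :
    ∃ (q : List (Bool × Bool)) (cy' : Bool), q.length ≤ N + 1 ∧
      bitsVal (q.map Prod.fst) = bitsVal f ∧
      (neg = false → bitsVal (q.map Prod.snd) = bitsVal r + bitsVal d + cy.toNat) ∧
      (neg = true → bitsVal (q.map Prod.snd) + bitsVal d + cy.toNat = bitsVal r) ∧
      RunsIn (N + 1)
        ⟨some .add, addQ neg inf ph c cy, tapes (d.map some) [] [] r f p []⟩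
        ⟨some .final, addQ neg inf ph (bif inf then some true else none) cy',
          tapes [] [] [] [] [] (q.reverse ++ p) []⟩ := by
  induction N generalizing r f d p cy with
  | zero =>
    simp only [Nat.le_zero, List.length_eq_zero_iff] at hr hf hd
    subst hr hf hd
    refine ⟨[(false, cy)], cy, by simp, by simp [bitsVal], ?_, ?_, ?_⟩
    · simp [bitsVal]
    · intro h; have := hneg h; simp only [bitsVal, List.map] at this ⊢; omega
    · refine RunsIn.head ?_ (RunsIn.refl _ _)
      simp [queryProgram, QState.clear, QState.init, addQ]
  | succ N ih =>
    by_cases h0 : r = [] ∧ f = [] ∧ d = []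
    · obtain ⟨rfl, rfl, rfl⟩ := h0
      obtain ⟨q, cy', h1, h2, h3, h4, h5⟩ := ih cy [] [] [] p (by simp) (by simp) (by simp) hneg
      exact ⟨q, cy', by omega, h2, h3, h4, (RunsIn.refl 0 _).trans h5 (by omega)⟩
    have va := nextCarry_add (r.head?.getD false) (d.head?.getD false) cy
    have vs := nextCarry_sub (r.head?.getD false) (d.head?.getD false) cy
    have vr := bitsVal_head_tail r
    have vd := bitsVal_head_tail d
    have vf := bitsVal_head_tail f
    have hx := Bool.toNat_le (xor (r.head?.getD false) (xor (d.head?.getD false) cy))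
    obtain ⟨q, cy', h1, h2, h3, h4, h5⟩ := ih
      (nextCarry neg (r.head?.getD false) (d.head?.getD false) cy) r.tail f.tail d.tail
      ((f.head?.getD false, xor (r.head?.getD false) (xor (d.head?.getD false) cy)) :: p)
      (by simp; omega) (by simp; omega) (by simp; omega)
      (by rintro rfl; have := hneg rfl; omega)
    refine ⟨(f.head?.getD false, xor (r.head?.getD false) (xor (d.head?.getD false) cy)) :: q,
      cy', by simpa using h1, ?_, ?_, ?_, ?_⟩
    · rw [List.map_cons, bitsVal, h2, vf]
    · rintro rfl; rw [List.map_cons, bitsVal, h3 rfl]; dsimp only; omega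
    · rintro rfl; rw [List.map_cons, bitsVal]; have := h4 rfl; dsimp only; omega
    · refine RunsIn.head (step_add _ _ _ _ _ _ _ _ _ h0) ?_
      simpa using h5

/-- The state of the machine while it writes the output. -/
def finalQ (neg inf : Bool) (ph : Phase) (cy : Bool) (c : Option Bool) (st : Bool) : QState :=
  { QState.init with neg := neg, ph := ph, c := c, inf := inf, cy := cy, st := st }

/-- The last loop writes the digits of the digitwise minimum behind those of `a`, without leading
zeros, and halts. -/
theorem runs_final (neg inf : Bool) (ph : Phase) (cy : Bool) (c : Option Bool)
    (p : List (Bool × Bool)) (a : ℕ) :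
    RunsIn (p.length + 1)
      ⟨some .final, finalQ neg inf ph cy c (decide (a ≠ 0)), tapes [] [] [] [] [] p a.bits⟩
      ⟨none, .init, tapes [] [] [] [] [] []
        (a * 2 ^ p.length + bitsValMSB (minDigits c p)).bits⟩ := by
  induction p generalizing a c with
  | nil =>
    refine RunsIn.head ?_ (RunsIn.refl _ _)
    simp [queryProgram, minDigits, bitsValMSB]
  | cons x p ih =>
    obtain ⟨u, v⟩ := x
    have e : a * 2 ^ ((u, v) :: p).length + bitsValMSB (minDigits c ((u, v) :: p)) =
        Nat.bit (minDigit c u v) a * 2 ^ p.length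
          + bitsValMSB (minDigits (minState c u v) p) := by
      simp only [minDigits, bitsValMSB, List.length_cons, length_minDigits, Nat.bit_val]; ring
    rw [e]
    refine RunsIn.head ?_ (ih (minState c u v) (Nat.bit (minDigit c u v) a))
    by_cases h : a = 0
    · subst h
      cases hb : minDigit c u v <;>
        simp [queryProgram, QState.clear, QState.init, finalQ, QState.payload, QState.digit, hb]
    · rw [Nat.bits_append_bit _ _ (fun h' => absurd h' h)]
      simp [queryProgram, QState.clear, QState.init, finalQ, QState.payload, QState.digit, h]

theorem initList_queryTM (l : List (Option Bool)) :
    Turing.initList queryTM l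
      = (⟨some .read₁, .init, tapes l [] [] [] [] [] []⟩ : QCfg) := by
  simp only [Turing.initList]
  congr 1
  funext k; cases k <;> rfl

theorem haltList_queryTM (l : List Bool) :
    Turing.haltList queryTM l = (⟨none, .init, tapes [] [] [] [] [] [] l⟩ : QCfg) := by
  simp only [Turing.haltList]
  congr 1
  funext k; cases k <;> rfl

/-- The correctness and the running time of the query machine, in terms of the result of the
scan. -/
theorem queryMachine_run (l m : List (Bool × Bool × Bool)) (hlm : l.length = m.length)
    (Δ : ℤ) (S : ScanState)
    (hS : (mergeSymbols l m).foldl .step ⟨.start, none, false, [], []⟩ = S)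
    (hnear : S.near.length ≤ l.length) (hfar : S.far.length ≤ l.length)
    (hΔ : 0 ≤ (bitsVal S.near : ℤ) + Δ) (T : ℝ)
    (hT : (9 * l.length + 2 * Δ.natAbs.bits.length + 10 : ℝ) ≤ T) :
    HaltsWithin queryMachine
      (queryInput (flatten₃ l).reverse (flatten₃ m).reverse Δ)
      (bif S.inf then ((bitsVal S.near : ℤ) + Δ).toNat
        else min (bitsVal S.far) ((bitsVal S.near : ℤ) + Δ).toNat).bits T := by
  set N := l.length + Δ.natAbs.bits.length with hN
  obtain ⟨q, cy, h1, h2, h3, h4, h5⟩ := runs_add (decide (Δ < 0)) S.inf S.ph S.c N false S.near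
    S.far Δ.natAbs.bits [] (by omega) (by omega) (by omega) (by
      rw [bitsVal_bits]; simp; omega)
  have e1 := runs_read₁ (flatten₃ l).reverse
    ((flatten₃ m).reverse.map some ++ none :: (intBits Δ).map some) []
  have e2 := runs_read₂ (flatten₃ m).reverse ((intBits Δ).map some) (flatten₃ l) []
  have e3 := runs_sign (decide (Δ < 0)) (Δ.natAbs.bits.map some) (flatten₃ l) (flatten₃ m)
  have e4 := runs_scan (decide (Δ < 0)) (Δ.natAbs.bits.map some) l m hlm
    ⟨.start, none, false, [], []⟩
  rw [hS] at e4
  have e6 := runs_final (decide (Δ < 0)) S.inf S.ph cy (bif S.inf then some true else none)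
    q.reverse 0
  have e : 0 * 2 ^ q.reverse.length
      + bitsValMSB (minDigits (bif S.inf then some true else none) q.reverse)
      = bif S.inf then ((bitsVal S.near : ℤ) + Δ).toNat
        else min (bitsVal S.far) ((bitsVal S.near : ℤ) + Δ).toNat := by
    have hz : bitsVal (q.map Prod.snd) = ((bitsVal S.near : ℤ) + Δ).toNat := by
      rw [bitsVal_bits] at h3 h4
      simp only [Bool.toNat_false, decide_eq_false_iff_not, decide_eq_true_eq] at h3 h4
      omega
    cases S.inf
    · simp only [cond_false, bitsValMSB_minDigits, List.map_reverse, bitsValMSB_reverse, h2, hz]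
      simp
    · simp only [cond_true, minDigits_true, List.map_reverse, bitsValMSB_reverse, hz]
      simp
  rw [e] at e6
  have hrun := ((((e1.trans (by simpa using e2) le_rfl).trans
    (by simpa [intBits, QState.init] using e3) le_rfl).trans
    (by simpa [scanQ, QState.init] using e4) le_rfl).trans
    (by simpa [addQ, scanQ, QState.init] using h5) le_rfl).trans
    (by simpa [addQ, finalQ, QState.init] using e6) le_rfl
  obtain ⟨k, hk, ek⟩ := hrun
  refine ⟨k, ?_, ⟨⟨⟨k, ?_⟩, le_rfl⟩⟩⟩
  · have : k ≤ 9 * l.length + 2 * Δ.natAbs.bits.length + 10 := by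
      refine hk.trans ?_
      simp only [List.length_reverse, length_flatten₃, ← hlm]
      omega
    refine le_trans ?_ hT
    exact_mod_cast this
  · have hi : queryInput (flatten₃ l).reverse (flatten₃ m).reverse Δ
        = (flatten₃ l).reverse.map some ++ none :: ((flatten₃ m).reverse.map some
          ++ none :: (intBits Δ).map some) := rfl
    have h1 := initList_queryTM (queryInput (flatten₃ l).reverse (flatten₃ m).reverse Δ)
    have h2 := haltList_queryTM (bif S.inf then ((bitsVal S.near : ℤ) + Δ).toNat
        else min (bitsVal S.far) ((bitsVal S.near : ℤ) + Δ).toNat).bits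
    rw [hi] at h1
    have ek' := ek.trans (congrArg some h2.symm)
    rw [← h1] at ek'
    have m₁ : ∀ l : List (Option Bool), l.map queryMachine.inputAlphabet.symm = l :=
      fun l => List.map_id l
    have m₂ : ∀ l : List Bool, l.map queryMachine.outputAlphabet.symm = l :=
      fun l => List.map_id l
    exact (congrArg (fun z => (flip bind (Turing.TM2.step queryProgram))^[k]
      (some (Turing.initList queryTM z))) (m₁ _)).trans
        (ek'.trans (congrArg (fun z => some (Turing.haltList queryTM z)) (m₂ _).symm))

/-! ### The layout of a label -/

/-- A block of a label: a header with a data bit for either role of the vertex, followed by the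
digits of a number for either role. -/
structure Block where
  /-- the header bit used if the vertex is the tail of the queried edge -/
  hdr₁ : Bool
  /-- the header bit used if the vertex is the head of the queried edge -/
  hdr₂ : Bool
  /-- the number used if the vertex is the tail of the queried edge -/
  val₁ : ℕ
  /-- the number used if the vertex is the head of the queried edge -/
  val₂ : ℕ

namespace Block

/-- The symbols of a block whose numbers are written with `B` digits. -/
def symbols (B : ℕ) (b : Block) : List (Bool × Bool × Bool) :=
  (true, b.hdr₁, b.hdr₂) ::
    ((digitsMSB B b.val₁).zip (digitsMSB B b.val₂)).map fun p => (false, p)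

/-- The block seen by the parallel scan of a block of the tail and a block of the head. -/
def merge (b b' : Block) : Block := ⟨b.hdr₁, b'.hdr₂, b.val₁, b'.val₂⟩

@[simp] theorem length_symbols (B : ℕ) (b : Block) : (b.symbols B).length = B + 1 := by
  simp [symbols]

/-- Both numbers of the block have at most `B` digits. -/
def Fits (B : ℕ) (b : Block) : Prop := b.val₁ < 2 ^ B ∧ b.val₂ < 2 ^ B

end Block

theorem length_flatMap_symbols (B : ℕ) (l : List Block) :
    (l.flatMap (Block.symbols B)).length = (B + 1) * l.length := by
  induction l with
  | nil => rfl
  | cons b l ih => simp [ih]; ring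

theorem mergeSymbols_symbols (B : ℕ) (b b' : Block) :
    mergeSymbols (b.symbols B) (b'.symbols B) = (b.merge b').symbols B := by
  have key : ∀ (w x y z : List Bool), w.length = x.length → y.length = z.length →
      mergeSymbols ((w.zip x).map fun p => (false, p)) ((y.zip z).map fun p => (false, p))
        = (w.zip z).map fun p => (false, p) := by
    intro w
    induction w with
    | nil => intro x y z h h'; simp [mergeSymbols]
    | cons a w ih =>
      intro x y z h h'
      obtain _ | ⟨a', x⟩ := x
      · simp at h
      obtain _ | ⟨c, y⟩ := y
      · obtain rfl : z = [] := List.length_eq_zero_iff.1 h'.symm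
        simp [mergeSymbols]
      obtain _ | ⟨c', z⟩ := z
      · simp at h'
      have := ih x y z (by simpa using h) (by simpa using h')
      simp only [mergeSymbols, List.zip_cons_cons, List.map_cons, List.zipWith_cons_cons] at this ⊢
      rw [this]
  have := key (digitsMSB B b.val₁) (digitsMSB B b.val₂) (digitsMSB B b'.val₁)
    (digitsMSB B b'.val₂) (by simp) (by simp)
  simp only [mergeSymbols, Block.symbols, Block.merge, List.zipWith_cons_cons] at this ⊢
  rw [this]

theorem mergeSymbols_flatMap (B : ℕ) (l m : List Block) :
    mergeSymbols (l.flatMap (Block.symbols B)) (m.flatMap (Block.symbols B))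
      = (List.zipWith Block.merge l m).flatMap (Block.symbols B) := by
  induction l generalizing m with
  | nil => simp [mergeSymbols]
  | cons b l ih =>
    obtain _ | ⟨b', m⟩ := m
    · simp [mergeSymbols]
    have h1 := mergeSymbols_symbols B b b'
    have h2 := ih m
    simp only [mergeSymbols, List.flatMap_cons, List.zipWith_cons_cons] at h1 h2 ⊢
    rw [List.zipWith_append (by simp), h1, h2]

/-- The value at the first block whose header bits differ. -/
def firstDiff : List Block → ℕ
  | [] => 0
  | b :: l => if b.hdr₁ = b.hdr₂ then firstDiff l else min b.val₁ b.val₂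

theorem foldl_step_digits (S : ScanState) (l : List (Bool × Bool)) :
    ∃ c, (l.map fun p => (false, p)).foldl ScanState.step S =
      { S with
        c := c
        near := if S.ph = .active then (minDigits S.c l).reverse ++ S.near else S.near
        far := if S.ph = .far then (minDigits S.c l).reverse ++ S.far else S.far } := by
  induction l generalizing S with
  | nil => exact ⟨S.c, by simp [minDigits]⟩
  | cons p l ih =>
    obtain ⟨u, v⟩ := p
    obtain ⟨c, hc⟩ := ih (S.step (false, u, v))
    refine ⟨c, ?_⟩
    rw [List.map_cons, List.foldl_cons, hc]
    by_cases h : S.ph = .active <;> by_cases h' : S.ph = .far <;>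
      simp [ScanState.step, minDigits, h, h']

theorem foldl_step_symbols (B : ℕ) (S : ScanState) (b : Block) :
    ∃ S₁, (b.symbols B).foldl ScanState.step S = S₁ ∧
      S₁.ph = S.ph.next b.hdr₁ b.hdr₂ ∧
      S₁.inf = (bif S.ph = .start then b.hdr₁ && b.hdr₂ else S.inf) ∧
      S₁.near = (if S.ph.next b.hdr₁ b.hdr₂ = .active then
        (minDigits none ((digitsMSB B b.val₁).zip (digitsMSB B b.val₂))).reverse ++ S.near
        else S.near) ∧
      S₁.far = (if S.ph.next b.hdr₁ b.hdr₂ = .far then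
        (minDigits none ((digitsMSB B b.val₁).zip (digitsMSB B b.val₂))).reverse ++ S.far
        else S.far) := by
  obtain ⟨c, hc⟩ := foldl_step_digits (S.step (true, b.hdr₁, b.hdr₂))
    ((digitsMSB B b.val₁).zip (digitsMSB B b.val₂))
  refine ⟨_, rfl, ?_⟩
  rw [Block.symbols, List.foldl_cons, hc]
  exact ⟨rfl, rfl, rfl, rfl⟩

theorem bitsVal_minDigits_digitsMSB {B : ℕ} {b : Block} (h : b.Fits B) :
    bitsVal (minDigits none ((digitsMSB B b.val₁).zip (digitsMSB B b.val₂))).reverse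
      = min b.val₁ b.val₂ := by
  rw [bitsVal_reverse, bitsValMSB_minDigits, List.map_fst_zip (by simp),
    List.map_snd_zip (by simp), bitsValMSB_digitsMSB h.1, bitsValMSB_digitsMSB h.2]

/-- Once the separating level is reached, the scan collects no more digits. -/
theorem scan_done (B : ℕ) (l : List Block) (S : ScanState)
    (hS : S.ph = .active ∨ S.ph = .done) :
    ((l.flatMap (Block.symbols B)).foldl ScanState.step S).inf = S.inf ∧
    ((l.flatMap (Block.symbols B)).foldl ScanState.step S).near = S.near ∧
    ((l.flatMap (Block.symbols B)).foldl ScanState.step S).far = S.far := by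
  induction l generalizing S with
  | nil => simp
  | cons b l ih =>
    obtain ⟨S₁, hS₁, hph, hinf, hnear, hfar⟩ := foldl_step_symbols B S b
    have h' : S.ph.next b.hdr₁ b.hdr₂ = .done := by rcases hS with h | h <;> rw [h] <;> rfl
    have h'' : S.ph ≠ .start := by rcases hS with h | h <;> rw [h] <;> decide
    rw [List.flatMap_cons, List.foldl_append, hS₁]
    have := ih S₁ (Or.inr (hph.trans h'))
    refine ⟨this.1.trans ?_, this.2.1.trans ?_, this.2.2.trans ?_⟩
    · simp [hinf, h'']
    · simp [hnear, h']
    · simp [hfar, h']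

/-- The scan collects the digits of the minimum of the two numbers in the first block whose header
bits differ. -/
theorem scan_levels (B : ℕ) (l : List Block) (hl : ∀ b ∈ l, b.Fits B)
    (hd : ∃ b ∈ l, b.hdr₁ ≠ b.hdr₂) (S : ScanState) (hS : S.ph = .far ∨ S.ph = .same)
    (hn : S.near = []) :
    ((l.flatMap (Block.symbols B)).foldl ScanState.step S).inf = S.inf ∧
    bitsVal ((l.flatMap (Block.symbols B)).foldl ScanState.step S).near = firstDiff l ∧
    ((l.flatMap (Block.symbols B)).foldl ScanState.step S).near.length = B ∧
    ((l.flatMap (Block.symbols B)).foldl ScanState.step S).far = S.far := by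
  induction l generalizing S with
  | nil => simp at hd
  | cons b l ih =>
    obtain ⟨S₁, hS₁, hph, hinf, hnear, hfar⟩ := foldl_step_symbols B S b
    have h'' : S.ph ≠ .start := by rcases hS with h | h <;> rw [h] <;> decide
    rw [List.flatMap_cons, List.foldl_append, hS₁]
    by_cases hb : b.hdr₁ = b.hdr₂
    · have h' : S.ph.next b.hdr₁ b.hdr₂ = .same := by
        rcases hS with h | h <;> simp [h, Phase.next, hb]
      have := ih (fun b hb => hl b (by simp [hb])) (by simpa [hb] using hd) S₁
        (Or.inr (hph.trans h')) (by simp [hnear, h', hn])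
      rw [firstDiff, if_pos hb]
      exact ⟨this.1.trans (by simp [hinf, h'']), this.2.1, this.2.2.1,
        this.2.2.2.trans (by simp [hfar, h'])⟩
    · have h' : S.ph.next b.hdr₁ b.hdr₂ = .active := by
        rcases hS with h | h <;> simp [h, Phase.next, hb]
      have := scan_done B l S₁ (Or.inl (hph.trans h'))
      rw [firstDiff, if_neg hb, this.1, this.2.1, this.2.2, hinf, hnear, hfar,
        ← bitsVal_minDigits_digitsMSB (hl b (by simp))]
      simp [h', h'', hn]

/-- The result of the scan of two labels made of blocks. -/
theorem scan_blocks (B : ℕ) (b : Block) (l : List Block) (hl : ∀ b' ∈ b :: l, b'.Fits B)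
    (hd : ∃ b ∈ l, b.hdr₁ ≠ b.hdr₂) :
    ∃ S, ((b :: l).flatMap (Block.symbols B)).foldl ScanState.step
        ⟨.start, none, false, [], []⟩ = S ∧
      S.inf = (b.hdr₁ && b.hdr₂) ∧ bitsVal S.near = firstDiff l ∧ S.near.length = B ∧
      bitsVal S.far = min b.val₁ b.val₂ ∧ S.far.length = B := by
  obtain ⟨S₁, hS₁, hph, hinf, hnear, hfar⟩ :=
    foldl_step_symbols B ⟨.start, none, false, [], []⟩ b
  refine ⟨_, rfl, ?_⟩
  rw [List.flatMap_cons, List.foldl_append, hS₁]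
  have := scan_levels B l (fun b hb => hl b (by simp [hb])) hd S₁ (Or.inl hph)
    (by simp [hnear, Phase.next])
  have e := bitsVal_minDigits_digitsMSB (hl b (by simp))
  refine ⟨this.1.trans (by simp [hinf]), this.2.1, this.2.2.1, ?_, ?_⟩
  · rw [this.2.2.2, ← e]; simp [hfar, Phase.next]
  · rw [this.2.2.2]; simp [hfar, Phase.next]

/-! ### Distances along a line from labels -/

/-- The middle of the dyadic interval of length `2 ^ (r + 1)` that contains `i`. -/
def dyadicMid (i r : ℕ) : ℕ := (i / 2 ^ (r + 1) * 2 + 1) * 2 ^ r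

/-- The blocks for the position `i` on a line with a min-additive distance `μ`: at each level, from
the highest one, the bit of the position and the distance to the middle of the dyadic interval, in
the role of the left point if `i` is in the left half, and in the role of the right point
otherwise. The last block always separates, and stands for the distance `big`. -/
def lineBlocks (μ : ℕ → ℕ → ℕ) (big i : ℕ) : ℕ → List Block
  | 0 => [⟨false, true, big, big⟩]
  | r + 1 => ⟨i.testBit r, i.testBit r,
      if i.testBit r then big else μ i (dyadicMid i r),
      if i.testBit r then μ (dyadicMid i r) i else big⟩ :: lineBlocks μ big i r

@[simp] theorem length_lineBlocks (μ : ℕ → ℕ → ℕ) (big i L : ℕ) :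
    (lineBlocks μ big i L).length = L + 1 := by
  induction L with
  | zero => rfl
  | succ L ih => simp [lineBlocks, ih]

theorem fits_lineBlocks (μ : ℕ → ℕ → ℕ) (big i L B : ℕ) (hμ : ∀ i j, μ i j ≤ big)
    (hB : big < 2 ^ B) : ∀ b ∈ lineBlocks μ big i L, b.Fits B := by
  induction L with
  | zero => simp [lineBlocks, Block.Fits, hB]
  | succ L ih =>
    simp only [lineBlocks, List.mem_cons, forall_eq_or_imp]
    refine ⟨⟨?_, ?_⟩, ih⟩ <;> dsimp only <;> split_ifs
    exacts [hB, (hμ _ _).trans_lt hB, (hμ _ _).trans_lt hB, hB]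

theorem fits_zipWith_merge (B : ℕ) (l m : List Block) (hl : ∀ b ∈ l, b.Fits B)
    (hm : ∀ b ∈ m, b.Fits B) : ∀ b ∈ List.zipWith Block.merge l m, b.Fits B := by
  induction l generalizing m with
  | nil => simp
  | cons b l ih =>
    obtain _ | ⟨b', m⟩ := m
    · simp
    simp only [List.mem_cons, forall_eq_or_imp, List.zipWith_cons_cons] at hl hm ⊢
    exact ⟨⟨hl.1.1, hm.1.2⟩, ih m hl.2 hm.2⟩

theorem exists_hdr_ne_lineBlocks (μ : ℕ → ℕ → ℕ) (big i j L : ℕ) :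
    ∃ b ∈ List.zipWith Block.merge (lineBlocks μ big i L) (lineBlocks μ big j L),
      b.hdr₁ ≠ b.hdr₂ := by
  induction L with
  | zero => simp [lineBlocks, Block.merge]
  | succ L ih =>
    obtain ⟨b, hb, hne⟩ := ih
    exact ⟨b, by simp [lineBlocks, hb], hne⟩

/-- The labels determine the distance: at the first level where the positions differ, the two
points are on different sides of the middle of their common dyadic interval. -/
theorem firstDiff_lineBlocks (μ : ℕ → ℕ → ℕ) (big i j L : ℕ)
    (hμ : ∀ m, i < m → m ≤ j → μ i j = min (μ i m) (μ m j)) (hij : i / 2 ^ L = j / 2 ^ L) :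
    firstDiff (List.zipWith Block.merge (lineBlocks μ big i L) (lineBlocks μ big j L))
      = if i < j then μ i j else big := by
  induction L with
  | zero =>
    obtain rfl : i = j := by simpa using hij
    simp [lineBlocks, Block.merge, firstDiff]
  | succ L ih =>
    simp only [lineBlocks, List.zipWith_cons_cons, Block.merge, firstDiff]
    have hi : ∀ i : ℕ, i / 2 ^ L = i / 2 ^ (L + 1) * 2 + (i.testBit L).toNat := by
      intro i
      have := Nat.div_add_mod (i / 2 ^ L) 2
      rw [Nat.div_div_eq_div_mul, ← pow_succ] at this
      rw [Nat.testBit_eq_decide_div_mod_eq]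
      rcases Nat.mod_two_eq_zero_or_one (i / 2 ^ L) with h | h <;> rw [h] at this <;>
        simp [h] <;> omega
    have hlow : ∀ k i : ℕ, i / 2 ^ L < k → i < k * 2 ^ L := fun k i h =>
      (Nat.div_lt_iff_lt_mul (by positivity)).1 h
    have hhigh : ∀ k i : ℕ, k ≤ i / 2 ^ L → k * 2 ^ L ≤ i := fun k i h =>
      (Nat.le_div_iff_mul_le (by positivity)).1 h
    have hI := hi i
    have hJ := hi j
    rw [← hij] at hJ
    have hm : dyadicMid j L = dyadicMid i L := by rw [dyadicMid, dyadicMid, hij]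
    rw [hm]
    cases h1 : i.testBit L <;> cases h2 : j.testBit L <;> rw [h1] at hI <;> rw [h2] at hJ
    · simpa using ih (by omega)
    · -- `i` is in the left half and `j` in the right half
      have a := hlow (i / 2 ^ (L + 1) * 2 + 1) i (by simp at hI; omega)
      have b := hhigh (i / 2 ^ (L + 1) * 2 + 1) j (by simp at hJ; omega)
      have := hμ (dyadicMid i L) a b
      rw [if_pos (by omega : i < j), this]
      simp
    · have a := hlow (i / 2 ^ (L + 1) * 2 + 1) j (by simp at hJ; omega)
      have b := hhigh (i / 2 ^ (L + 1) * 2 + 1) i (by simp at hI; omega)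
      rw [if_neg (by omega : ¬ i < j)]
      simp
    · simpa using ih (by omega)

/-! ### Cuts that cross an edge -/

section Cuts

variable {V : Type*} [DecidableEq V]

theorem cutCapacity_eq_sum_ite (E : Finset (V × V)) (w : V × V → ℕ) (C : Finset V) :
    cutCapacity E w C = ∑ e ∈ E, if e.1 ∈ C ∧ e.2 ∉ C then w e else 0 := by
  rw [cutCapacity, Finset.sum_filter]

theorem cutCapacity_le_sum (E : Finset (V × V)) (w : V × V → ℕ) (C : Finset V) :
    cutCapacity E w C ≤ ∑ e ∈ E, w e :=
  Finset.sum_le_sum_of_subset (Finset.filter_subset _ _)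

theorem weight_le_cutCapacity {E : Finset (V × V)} (w : V × V → ℕ) {C : Finset V} {x y : V}
    (he : (x, y) ∈ E) (hx : x ∈ C) (hy : y ∉ C) : w (x, y) ≤ cutCapacity E w C :=
  Finset.single_le_sum (f := w) (fun _ _ => Nat.zero_le _) (by simp [he, hx, hy])

/-- Submodularity of the cut capacity, with the edges between the two differences. -/
theorem cutCapacity_inter_add_union (E : Finset (V × V)) (w : V × V → ℕ) (C C' : Finset V)
    (D : Finset (V × V)) (hD : D ⊆ E)
    (h : ∀ e ∈ D, (e.1 ∈ C ∧ e.1 ∉ C' ∧ e.2 ∉ C ∧ e.2 ∈ C') ∨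
      (e.1 ∉ C ∧ e.1 ∈ C' ∧ e.2 ∈ C ∧ e.2 ∉ C')) :
    cutCapacity E w (C ∩ C') + cutCapacity E w (C ∪ C') + ∑ e ∈ D, w e
      ≤ cutCapacity E w C + cutCapacity E w C' := by
  have e : ∑ e ∈ D, w e = ∑ e ∈ E, if e ∈ D then w e else 0 := by
    rw [← Finset.sum_filter, Finset.filter_mem_eq_inter, Finset.inter_eq_right.2 hD]
  simp only [cutCapacity_eq_sum_ite, e, ← Finset.sum_add_distrib]
  refine Finset.sum_le_sum fun e _ => ?_
  have he := h e
  by_cases h1 : e.1 ∈ C <;> by_cases h2 : e.1 ∈ C' <;> by_cases h3 : e.2 ∈ C <;>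
    by_cases h4 : e.2 ∈ C' <;> by_cases h5 : e ∈ D <;> simp_all

theorem minCutCapacity_le (E : Finset (V × V)) (w : V × V → ℕ) {s t : V} {C : Finset V}
    (hs : s ∈ C) (ht : t ∉ C) : minCutCapacity E w s t ≤ cutCapacity E w C :=
  Nat.sInf_le ⟨C, hs, ht, rfl⟩

theorem exists_minCut (E : Finset (V × V)) (w : V × V → ℕ) {s t : V} (h : s ≠ t) :
    ∃ C : Finset V, s ∈ C ∧ t ∉ C ∧ cutCapacity E w C = minCutCapacity E w s t :=
  (minCutCapacity_isLeast E w h).1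

/-- The capacity of a cut after the change of the capacity of an edge. -/
theorem cutCapacity_update (E : Finset (V × V)) (w : V × V → ℕ) {e : V × V} (he : e ∈ E) (a : ℕ)
    (C : Finset V) :
    cutCapacity E (Function.update w e a) C + (if e.1 ∈ C ∧ e.2 ∉ C then w e else 0)
      = cutCapacity E w C + if e.1 ∈ C ∧ e.2 ∉ C then a else 0 := by
  rw [cutCapacity_eq_sum_ite, cutCapacity_eq_sum_ite, ← Finset.add_sum_erase _ _ he,
    ← Finset.add_sum_erase E _ he]
  have : ∀ f ∈ E.erase e, (if f.1 ∈ C ∧ f.2 ∉ C then Function.update w e a f else 0)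
      = if f.1 ∈ C ∧ f.2 ∉ C then w f else 0 := by
    intro f hf
    rw [Function.update_of_ne (Finset.ne_of_mem_erase hf)]
  rw [Finset.sum_congr rfl this, Function.update_self]
  ring

namespace WeightedDigraph

variable (G : WeightedDigraph V) (s t : V)

/-- The set of vertices `C` is an `(s,t)`-cut that the edge `(x, y)` leaves. -/
def Crosses (x y : V) (C : Finset V) : Prop := s ∈ C ∧ t ∉ C ∧ x ∈ C ∧ y ∉ C

/-- A vital edge: its removal decreases the capacity of the mincut. -/
def IsVital (x y : V) : Prop :=
  (x, y) ∈ G.edges ∧ ∃ C, Crosses s t x y C ∧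
    cutCapacity G.edges G.weight C < minCutCapacity G.edges G.weight s t + G.weight (x, y)

/-- A cut of least capacity among those that the edge `(x, y)` leaves. -/
def IsMinCross (x y : V) (C : Finset V) : Prop :=
  Crosses s t x y C ∧
    ∀ C', Crosses s t x y C' → cutCapacity G.edges G.weight C ≤ cutCapacity G.edges G.weight C'

variable {G s t}

theorem IsVital.exists_isMinCross {x y : V} (h : G.IsVital s t x y) :
    ∃ C, G.IsMinCross s t x y C := by
  obtain ⟨-, C, hC, -⟩ := h
  obtain ⟨C₀, h₀, hmin⟩ := exists_minimal_of_wellFoundedLT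
    (fun c => ∃ C, Crosses s t x y C ∧ cutCapacity G.edges G.weight C = c) ⟨_, C, hC, rfl⟩
  obtain ⟨D, hD, rfl⟩ := h₀
  exact ⟨D, hD, fun C' h' => by
    by_contra! hlt
    exact absurd (hmin ⟨C', h', rfl⟩ hlt.le) (by simpa using hlt)⟩

/-- No vital edge enters the mincut of another one: otherwise uncrossing the two mincuts gives two
cuts that are too small. This is what makes a direction-blind search for a separating cut
correct. -/
theorem IsMinCross.not_enters {x y x' y' : V} {C : Finset V} (h : G.IsVital s t x y)
    (hC : G.IsMinCross s t x y C) (h' : G.IsVital s t x' y') : ¬ (y' ∈ C ∧ x' ∉ C) := by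
  rintro ⟨hy', hx'⟩
  obtain ⟨he, D, hD, hlt⟩ := h
  obtain ⟨he', C', ⟨hs', ht', hx'', hy''⟩, hlt'⟩ := h'
  have hle := hC.2 D hD
  obtain ⟨⟨hs, ht, hx, hy⟩, hmin⟩ := hC
  have hi := minCutCapacity_le G.edges G.weight (C := C ∩ C') (s := s) (t := t)
    (by simp [hs, hs']) (by simp [ht])
  have hu := minCutCapacity_le G.edges G.weight (C := C ∪ C') (s := s) (t := t)
    (by simp [hs]) (by simp [ht, ht'])
  have sub := cutCapacity_inter_add_union G.edges G.weight C C' {(x', y')} (by simpa using he')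
    (by simp [hx', hy', hx'', hy''])
  rw [Finset.sum_singleton] at sub
  -- both uncrossed cuts are smaller than `C`, so `(x, y)` leaves neither of them
  have hxC' : x ∉ C' := fun hx₁ => by
    have := hmin (C ∩ C') ⟨by simp [hs, hs'], by simp [ht], by simp [hx, hx₁], by simp [hy]⟩
    omega
  have hyC' : y ∈ C' := by
    by_contra hy₁
    have := hmin (C ∪ C') ⟨by simp [hs], by simp [ht, ht'], by simp [hx], by simp [hy, hy₁]⟩
    omega
  -- hence `(x, y)` passes between the differences too, and counts a second time
  have sub₂ := cutCapacity_inter_add_union G.edges G.weight C C' {(x, y), (x', y')}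
    (by simp [Finset.insert_subset_iff, he, he']) (by simp [*])
  rw [Finset.sum_pair (by rintro ⟨⟩; exact hx' hx)] at sub₂
  omega

end WeightedDigraph

end Cuts

/-! ### The lexicographic order of a sorted list of cuts -/

section CutList

variable {V : Type*} [DecidableEq V] (cap : Finset V → ℕ) (big : ℕ)

/-- The rank of a vertex in the lexicographic order given by a list of cuts: vertices inside a cut
come before those outside. -/
def cutKey : List (Finset V) → V → ℕ
  | [], _ => 0
  | C :: cs, v => (if v ∈ C then 0 else 2 ^ cs.length) + cutKey cs v

/-- The capacity of the first cut of the list that separates two vertices, in either direction,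
and `big` if there is none. -/
def cutDist : List (Finset V) → V → V → ℕ
  | [], _, _ => big
  | C :: cs, x, y => if x ∈ C ↔ y ∈ C then cutDist cs x y else cap C

theorem cutKey_lt (cs : List (Finset V)) (v : V) : cutKey cs v < 2 ^ cs.length := by
  induction cs with
  | nil => simp [cutKey]
  | cons C cs ih => simp only [cutKey, List.length_cons, pow_succ]; split_ifs <;> omega

variable {cap big}

theorem cutDist_le (cs : List (Finset V)) (h : ∀ C, cap C ≤ big) (x y : V) :
    cutDist cap big cs x y ≤ big := by
  induction cs with
  | nil => exact le_rfl
  | cons C cs ih => rw [cutDist]; split_ifs; exacts [ih, h C]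

theorem le_cutDist (cs : List (Finset V)) (h : ∀ C, cap C ≤ big) (C : Finset V)
    (hC : ∀ C' ∈ cs, cap C ≤ cap C') (x y : V) : cap C ≤ cutDist cap big cs x y := by
  induction cs with
  | nil => exact h C
  | cons D cs ih =>
    rw [cutDist]
    split_ifs
    exacts [ih fun C' h' => hC C' (by simp [h']), hC D (by simp)]

theorem cutDist_eq_min (cs : List (Finset V)) (hs : cs.Pairwise fun C D => cap C ≤ cap D)
    (h : ∀ C, cap C ≤ big) {x y z : V} (h1 : cutKey cs x ≤ cutKey cs z)
    (h2 : cutKey cs z ≤ cutKey cs y) :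
    cutDist cap big cs x y = min (cutDist cap big cs x z) (cutDist cap big cs z y) := by
  induction cs with
  | nil => simp [cutDist]
  | cons C cs ih =>
    rw [List.pairwise_cons] at hs
    have ih := ih hs.2
    have kx := cutKey_lt cs x
    have ky := cutKey_lt cs y
    have kz := cutKey_lt cs z
    have dxz := le_cutDist cs h C hs.1 x z
    have dzy := le_cutDist cs h C hs.1 z y
    simp only [cutKey] at h1 h2
    simp only [cutDist]
    by_cases hx : x ∈ C <;> by_cases hy : y ∈ C <;> by_cases hz : z ∈ C <;>
      simp only [hx, hy, hz, if_true, if_false, iff_true, iff_false, not_true_eq_false,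
        min_self, zero_add, min_eq_left, min_eq_right, dxz, dzy] at h1 h2 ⊢ <;>
      omega

theorem cutDist_eq_big_or (cs : List (Finset V)) {x y : V} (h : cutKey cs x ≤ cutKey cs y) :
    cutDist cap big cs x y = big ∨
      ∃ C ∈ cs, x ∈ C ∧ y ∉ C ∧ cap C = cutDist cap big cs x y := by
  induction cs with
  | nil => exact Or.inl rfl
  | cons C cs ih =>
    have kx := cutKey_lt cs x
    have ky := cutKey_lt cs y
    simp only [cutKey] at h
    simp only [cutDist]
    by_cases hxy : x ∈ C ↔ y ∈ C
    · rw [if_pos hxy]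
      rw [if_congr hxy rfl rfl] at h
      rcases ih (by omega) with ih | ⟨D, hD, ih⟩
      exacts [Or.inl ih, Or.inr ⟨D, by simp [hD], ih⟩]
    · rw [if_neg hxy]
      refine Or.inr ⟨C, by simp, ?_⟩
      by_cases hx : x ∈ C <;> by_cases hy : y ∈ C <;> simp_all
      omega

theorem cutDist_le_of_mem (cs : List (Finset V)) (hs : cs.Pairwise fun C D => cap C ≤ cap D)
    {C : Finset V} (hC : C ∈ cs) {x y : V} (hx : x ∈ C) (hy : y ∉ C) :
    cutDist cap big cs x y ≤ cap C := by
  induction cs with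
  | nil => simp at hC
  | cons D cs ih =>
    rw [List.pairwise_cons] at hs
    rw [cutDist]
    rcases List.mem_cons.1 hC with rfl | hC
    · simp [hx, hy]
    · split_ifs
      exacts [ih hs.2 hC, hs.1 C hC]

theorem cutKey_lt_cutKey (cs : List (Finset V)) {x y : V} (hxy : ∀ C ∈ cs, ¬ (y ∈ C ∧ x ∉ C))
    (h : ∃ C ∈ cs, x ∈ C ∧ y ∉ C) : cutKey cs x < cutKey cs y := by
  induction cs with
  | nil => simp at h
  | cons C cs ih =>
    have kx := cutKey_lt cs x
    simp only [List.mem_cons, forall_eq_or_imp, exists_eq_or_imp] at hxy h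
    simp only [cutKey]
    have ih := ih hxy.2
    by_cases hx : x ∈ C <;> by_cases hy : y ∈ C <;> simp_all
    omega

end CutList

/-! ### The mincut after a change of capacity -/

namespace WeightedDigraph

variable {V : Type*} [DecidableEq V] (G : WeightedDigraph V) (s t : V)

/-- The number that stands for an infinite capacity. It is at least the capacity of any cut plus the
capacity of any edge, so that even after the capacity of an edge has been lowered it does not fall
below a mincut. -/
def capBound : ℕ := ∑ e ∈ G.edges, G.weight e + G.maxWeight

/-- The least capacity of an `(s,t)`-cut that does not contain `x`, and `capBound` for `x = s`, when
there is no such cut. -/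
noncomputable def avoidCap (x : V) : ℕ :=
  if x = s then G.capBound
  else sInf {c | ∃ C, s ∈ C ∧ t ∉ C ∧ x ∉ C ∧ cutCapacity G.edges G.weight C = c}

/-- The least capacity of an `(s,t)`-cut that contains `y`, and `capBound` for `y = t`, when there
is no such cut. -/
noncomputable def containCap (y : V) : ℕ :=
  if y = t then G.capBound
  else sInf {c | ∃ C, s ∈ C ∧ t ∉ C ∧ y ∈ C ∧ cutCapacity G.edges G.weight C = c}

variable {G s t}

theorem cutCapacity_le_capBound (C : Finset V) :
    cutCapacity G.edges G.weight C ≤ G.capBound :=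
  (cutCapacity_le_sum _ _ _).trans (Nat.le_add_right _ _)

theorem avoidCap_le {x : V} {C : Finset V} (hs : s ∈ C) (ht : t ∉ C) (hx : x ∉ C) :
    G.avoidCap s t x ≤ cutCapacity G.edges G.weight C := by
  rw [avoidCap, if_neg (by rintro rfl; exact hx hs)]
  exact Nat.sInf_le ⟨C, hs, ht, hx, rfl⟩

theorem containCap_le {y : V} {C : Finset V} (hs : s ∈ C) (ht : t ∉ C) (hy : y ∈ C) :
    G.containCap s t y ≤ cutCapacity G.edges G.weight C := by
  rw [containCap, if_neg (by rintro rfl; exact ht hy)]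
  exact Nat.sInf_le ⟨C, hs, ht, hy, rfl⟩

theorem exists_avoidCap (hst : s ≠ t) {x : V} (hx : x ≠ s) :
    ∃ C, s ∈ C ∧ t ∉ C ∧ x ∉ C ∧ cutCapacity G.edges G.weight C = G.avoidCap s t x := by
  rw [avoidCap, if_neg hx]
  exact Nat.sInf_mem (s := {c | ∃ C, s ∈ C ∧ t ∉ C ∧ x ∉ C ∧ cutCapacity G.edges G.weight C = c})
    ⟨_, {s}, by simp, by simpa using hst.symm, by simpa using hx, rfl⟩

theorem exists_containCap (hst : s ≠ t) {y : V} (hy : y ≠ t) :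
    ∃ C, s ∈ C ∧ t ∉ C ∧ y ∈ C ∧ cutCapacity G.edges G.weight C = G.containCap s t y := by
  rw [containCap, if_neg hy]
  exact Nat.sInf_mem (s := {c | ∃ C, s ∈ C ∧ t ∉ C ∧ y ∈ C ∧ cutCapacity G.edges G.weight C = c})
    ⟨_, {s, y}, by simp, by simp [hst.symm, hy.symm], by simp, rfl⟩

theorem avoidCap_le_capBound (hst : s ≠ t) (x : V) : G.avoidCap s t x ≤ G.capBound := by
  by_cases hx : x = s
  · simp [avoidCap, hx]
  · obtain ⟨C, -, -, -, h⟩ := exists_avoidCap (G := G) hst hx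
    exact h ▸ cutCapacity_le_capBound C

theorem containCap_le_capBound (hst : s ≠ t) (y : V) : G.containCap s t y ≤ G.capBound := by
  by_cases hy : y = t
  · simp [containCap, hy]
  · obtain ⟨C, -, -, -, h⟩ := exists_containCap (G := G) hst hy
    exact h ▸ cutCapacity_le_capBound C

/-- Unless `x = s` and `y = t`, the smaller one of the numbers of `x` and `y` is attained by a cut
that the edge `(x, y)` does not leave: such a cut is one that avoids `x` or contains `y`. -/
theorem exists_min_avoidCap_containCap (hst : s ≠ t) {x y : V} (h : ¬ (x = s ∧ y = t)) :
    ∃ C, s ∈ C ∧ t ∉ C ∧ ¬ (x ∈ C ∧ y ∉ C) ∧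
      cutCapacity G.edges G.weight C ≤ min (G.avoidCap s t x) (G.containCap s t y) := by
  have hA := avoidCap_le_capBound (G := G) hst x
  have hB := containCap_le_capBound (G := G) hst y
  by_cases hx : x = s
  · obtain ⟨C, h1, h2, h3, h4⟩ := exists_containCap (G := G) hst (y := y) (by tauto)
    refine ⟨C, h1, h2, by tauto, ?_⟩
    simp only [avoidCap, if_pos hx]
    omega
  by_cases hy : y = t
  · obtain ⟨C, h1, h2, h3, h4⟩ := exists_avoidCap (G := G) hst hx
    refine ⟨C, h1, h2, by tauto, ?_⟩
    simp only [containCap, if_pos hy]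
    omega
  rcases le_total (G.avoidCap s t x) (G.containCap s t y) with h | h
  · obtain ⟨C, h1, h2, h3, h4⟩ := exists_avoidCap (G := G) hst hx
    exact ⟨C, h1, h2, by tauto, by omega⟩
  · obtain ⟨C, h1, h2, h3, h4⟩ := exists_containCap (G := G) hst hy
    exact ⟨C, h1, h2, by tauto, by omega⟩

theorem cutCapacity_changedWeight {x y : V} (he : (x, y) ∈ G.edges) {Δ : ℤ}
    (hΔ : -(G.weight (x, y) : ℤ) ≤ Δ) (C : Finset V) :
    (cutCapacity G.edges (G.changedWeight (x, y) Δ) C : ℤ)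
      = cutCapacity G.edges G.weight C + if x ∈ C ∧ y ∉ C then Δ else 0 := by
  have := cutCapacity_update G.edges G.weight he ((G.weight (x, y) : ℤ) + Δ).toNat C
  rw [changedWeight]
  split_ifs at this ⊢ <;> omega

/-- The mincut after a change of the capacity of the edge `(x, y)`, in terms of any number `near`
that is the least capacity of a cut that `(x, y)` leaves if the edge is vital, and otherwise not
smaller than this capacity, or the bound `capBound`. -/
theorem minCutCapacity_changedWeight (hst : s ≠ t) {x y : V} (he : (x, y) ∈ G.edges) {Δ : ℤ}
    (hΔ : -(G.weight (x, y) : ℤ) ≤ Δ) {near : ℕ}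
    (h1 : near = G.capBound ∨ ∃ C, Crosses s t x y C ∧ cutCapacity G.edges G.weight C = near)
    (h2 : G.IsVital s t x y → ∀ C, Crosses s t x y C → near ≤ cutCapacity G.edges G.weight C) :
    0 ≤ (near : ℤ) + Δ ∧
    minCutCapacity G.edges (G.changedWeight (x, y) Δ) s t =
      bif decide (x = s) && decide (y = t) then ((near : ℤ) + Δ).toNat
      else min (min (G.avoidCap s t x) (G.containCap s t y)) ((near : ℤ) + Δ).toNat := by
  have hw : G.weight (x, y) ≤ G.maxWeight := Finset.le_sup (f := G.weight) he
  obtain ⟨K, hK, hbound⟩ : ∃ K, G.capBound = K + G.maxWeight ∧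
      ∀ C, cutCapacity G.edges G.weight C ≤ K := ⟨_, rfl, cutCapacity_le_sum _ _⟩
  have h0 : 0 ≤ (near : ℤ) + Δ := by
    rcases h1 with rfl | ⟨C, hC, rfl⟩
    · omega
    · have := weight_le_cutCapacity G.weight he hC.2.2.1 hC.2.2.2
      omega
  refine ⟨h0, ?_⟩
  have hcap := cutCapacity_changedWeight he hΔ
  have hcross : ∀ C, x ∈ C ∧ y ∉ C → (cutCapacity G.edges (G.changedWeight (x, y) Δ) C : ℤ)
      = cutCapacity G.edges G.weight C + Δ := fun C h => by rw [hcap, if_pos h]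
  have hnot : ∀ C, ¬ (x ∈ C ∧ y ∉ C) → cutCapacity G.edges (G.changedWeight (x, y) Δ) C
      = cutCapacity G.edges G.weight C := fun C h => by
    have := hcap C
    rw [if_neg h] at this
    omega
  have hfar : ∀ C, s ∈ C → t ∉ C → ¬ (x ∈ C ∧ y ∉ C) →
      min (G.avoidCap s t x) (G.containCap s t y) ≤ cutCapacity G.edges G.weight C := by
    intro C hs ht hC
    by_cases hx : x ∈ C
    · exact (min_le_right _ _).trans (containCap_le hs ht (by tauto))
    · exact (min_le_left _ _).trans (avoidCap_le hs ht hx)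
  obtain ⟨C₀, hs₀, ht₀, hC₀⟩ := exists_minCut G.edges G.weight hst
  have hpos := G.weight_pos _ he
  apply le_antisymm
  · -- some cut has at most the stated capacity
    have hn : minCutCapacity G.edges (G.changedWeight (x, y) Δ) s t ≤ ((near : ℤ) + Δ).toNat := by
      rcases h1 with rfl | ⟨C, hC, rfl⟩
      · refine (minCutCapacity_le _ _ hs₀ ht₀).trans ?_
        have := hcap C₀
        have := hbound C₀
        split_ifs at * <;> omega
      · refine (minCutCapacity_le _ _ hC.1 hC.2.1).trans ?_
        have := hcross C hC.2.2
        omega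
    by_cases hxy : x = s ∧ y = t
    · simpa [hxy] using hn
    · obtain ⟨C, hs, ht, hC, hle⟩ := exists_min_avoidCap_containCap (G := G) hst hxy
      have hdec : (decide (x = s) && decide (y = t)) = false := by simpa using hxy
      rw [hdec, cond_false]
      exact le_min ((minCutCapacity_le _ _ hs ht).trans (by rw [hnot C hC]; exact hle)) hn
  · -- every cut has at least the stated capacity
    obtain ⟨C, hs, ht, hC⟩ := exists_minCut G.edges (G.changedWeight (x, y) Δ) hst
    rw [← hC]
    have hfar' : ∀ D, s ∈ D → t ∉ D → ¬ (x ∈ D ∧ y ∉ D) →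
        (bif decide (x = s) && decide (y = t) then ((near : ℤ) + Δ).toNat
          else min (min (G.avoidCap s t x) (G.containCap s t y)) ((near : ℤ) + Δ).toNat)
        ≤ cutCapacity G.edges G.weight D := by
      intro D hs ht hD
      have hxy : ¬ (x = s ∧ y = t) := by rintro ⟨rfl, rfl⟩; exact hD ⟨hs, ht⟩
      have hdec : (decide (x = s) && decide (y = t)) = false := by simpa using hxy
      rw [hdec, cond_false]
      exact (min_le_left _ _).trans (hfar D hs ht hD)
    by_cases hc : x ∈ C ∧ y ∉ C
    · by_cases hv : G.IsVital s t x y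
      · have := h2 hv C ⟨hs, ht, hc⟩
        have := hcross C hc
        have : ((near : ℤ) + Δ).toNat ≤ cutCapacity G.edges (G.changedWeight (x, y) Δ) C := by
          omega
        cases (decide (x = s) && decide (y = t))
        exacts [(min_le_right _ _).trans this, this]
      · -- the mincut of `G` avoids an edge that is not vital, and stays minimal
        have hv' : ∀ D, Crosses s t x y D → minCutCapacity G.edges G.weight s t
            + G.weight (x, y) ≤ cutCapacity G.edges G.weight D := fun D hD => by
          by_contra! hlt
          exact hv ⟨he, D, hD, hlt⟩
        have hC₀' : ¬ (x ∈ C₀ ∧ y ∉ C₀) := fun h => by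
          have := hv' C₀ ⟨hs₀, ht₀, h⟩
          omega
        refine (hfar' C₀ hs₀ ht₀ hC₀').trans ?_
        have := hv' C ⟨hs, ht, hc⟩
        have := hcross C hc
        omega
    · rw [hnot C hc]
      exact hfar' C hs ht hc

/-- The vertices can be put on a line with a min-additive distance `μ`, such that the distance from
`x` to a later vertex `y` is the capacity of a cut that contains `x` and not `y`, or infinite
(`capBound`), and such that a vital edge points forward and the distance of its end vertices is at
most the capacity of every cut that it leaves. The order is the lexicographic one given by the
mincuts for vital edges, sorted by capacity. -/
theorem exists_line [Fintype V] (G : WeightedDigraph V) (s t : V) :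
    ∃ (pos : V → ℕ) (μ : ℕ → ℕ → ℕ), (∀ v, pos v < Fintype.card V) ∧
      (∀ i j, μ i j ≤ G.capBound) ∧
      (∀ i m j, i < m → m ≤ j → j < Fintype.card V → μ i j = min (μ i m) (μ m j)) ∧
      (∀ x y, pos x < pos y → μ (pos x) (pos y) = G.capBound ∨
        ∃ C, Crosses s t x y C ∧ cutCapacity G.edges G.weight C = μ (pos x) (pos y)) ∧
      (∀ x y, G.IsVital s t x y → pos x < pos y ∧
        ∀ C, Crosses s t x y C → μ (pos x) (pos y) ≤ cutCapacity G.edges G.weight C) := by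
  classical
  set cap := cutCapacity G.edges G.weight
  have hcap : ∀ C, cap C ≤ G.capBound := cutCapacity_le_capBound
  obtain ⟨cs, hsort, hmem⟩ : ∃ cs : List (Finset V), (cs.Pairwise fun C D => cap C ≤ cap D) ∧
      ∀ C, C ∈ cs ↔ ∃ x y, G.IsVital s t x y ∧ G.IsMinCross s t x y C := by
    refine ⟨(Finset.univ.filter fun C : Finset V =>
      ∃ x y, G.IsVital s t x y ∧ G.IsMinCross s t x y C).toList.mergeSort
        (fun C D => decide (cap C ≤ cap D)), ?_, fun C => by simp⟩
    have := List.pairwise_mergeSort (le := fun C D => decide (cap C ≤ cap D))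
      (fun a b c => by simpa using le_trans) (fun a b => by simpa using le_total _ _)
      (Finset.univ.filter fun C : Finset V =>
        ∃ x y, G.IsVital s t x y ∧ G.IsMinCross s t x y C).toList
    simpa using this
  set e := Fintype.equivFin V
  set σ := Tuple.sort (cutKey cs ∘ e.symm)
  have hmono : Monotone ((cutKey cs ∘ e.symm) ∘ σ) := Tuple.monotone_sort _
  set vtx : Fin (Fintype.card V) → V := fun i => e.symm (σ i)
  set pos : V → Fin (Fintype.card V) := fun v => σ.symm (e v)
  have hvp : ∀ v, vtx (pos v) = v := fun v => by simp [vtx, pos]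
  have hkey : ∀ i j, i ≤ j → cutKey cs (vtx i) ≤ cutKey cs (vtx j) := fun i j h => hmono h
  have hlt : ∀ x y, cutKey cs x < cutKey cs y → pos x < pos y := fun x y h => by
    by_contra! hle
    have := hkey _ _ hle
    rw [hvp, hvp] at this
    omega
  refine ⟨fun v => pos v, fun i j => if h : i < Fintype.card V ∧ j < Fintype.card V then
    cutDist cap G.capBound cs (vtx ⟨i, h.1⟩) (vtx ⟨j, h.2⟩) else G.capBound,
    fun v => (pos v).2, ?_, ?_, ?_, ?_⟩
  · intro i j
    dsimp only
    split_ifs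
    exacts [cutDist_le _ hcap _ _, le_rfl]
  · intro i m j him hmj hj
    dsimp only
    rw [dif_pos ⟨by omega, hj⟩, dif_pos ⟨by omega, by omega⟩, dif_pos ⟨by omega, hj⟩]
    exact cutDist_eq_min cs hsort hcap (hkey _ _ him.le) (hkey _ _ hmj)
  · intro x y hxy
    dsimp only
    rw [dif_pos ⟨(pos x).2, (pos y).2⟩]
    simp only [Fin.eta, hvp]
    have := hkey _ _ (Fin.le_of_lt hxy)
    rw [hvp, hvp] at this
    rcases cutDist_eq_big_or (cap := cap) (big := G.capBound) cs this with h | ⟨C, hC, hx, hy, h⟩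
    · exact Or.inl h
    · obtain ⟨x', y', -, hC'⟩ := (hmem C).1 hC
      exact Or.inr ⟨C, ⟨hC'.1.1, hC'.1.2.1, hx, hy⟩, h⟩
  · intro x y hv
    obtain ⟨C, hC⟩ := hv.exists_isMinCross
    have hCm : C ∈ cs := (hmem C).2 ⟨x, y, hv, hC⟩
    refine ⟨hlt _ _ (cutKey_lt_cutKey cs ?_ ⟨C, hCm, hC.1.2.2⟩), fun D hD => ?_⟩
    · intro D hD
      obtain ⟨x', y', hv', hD'⟩ := (hmem D).1 hD
      exact hD'.not_enters hv' hv
    · dsimp only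
      rw [dif_pos ⟨(pos x).2, (pos y).2⟩]
      simp only [Fin.eta, hvp]
      exact (cutDist_le_of_mem cs hsort hCm hC.1.2.2.1 hC.1.2.2.2).trans (hC.2 D hD)

end WeightedDigraph

/-! ### The length of the labels and the running time -/

theorem natSize_mul_log_two_le {m : ℕ} {a : ℝ} (hm : m ≠ 0) (ha : (2 * m : ℝ) ≤ a) :
    (Nat.size m : ℝ) * Real.log 2 ≤ Real.log a := by
  have h1 : 2 ^ Nat.size m ≤ 2 * m := by
    have h := Nat.lt_size.1 (Nat.sub_lt (Nat.size_pos.2 (Nat.pos_of_ne_zero hm)) one_pos)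
    have h' : Nat.size m = Nat.size m - 1 + 1 := by
      have := Nat.size_pos.2 (Nat.pos_of_ne_zero hm)
      omega
    rw [h', pow_succ]
    omega
  have h2 : (2 : ℝ) ^ Nat.size m ≤ a := le_trans (by exact_mod_cast h1) ha
  rw [← Real.log_pow]
  exact Real.log_le_log (by positivity) h2

theorem two_thirds_lt_log_two : (2 / 3 : ℝ) < Real.log 2 :=
  lt_trans (by norm_num) Real.log_two_gt_d9

theorem natSize_le_log {n : ℕ} (hn : 2 ≤ n) : (Nat.size n : ℝ) ≤ 3 * Real.log n := by
  have hn' : (2 : ℝ) ≤ n := by exact_mod_cast hn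
  have h := natSize_mul_log_two_le (m := n) (a := (n : ℝ) ^ 2) (by omega) (by nlinarith)
  rw [Real.log_pow] at h
  have := two_thirds_lt_log_two
  have h0 : (0 : ℝ) ≤ Nat.size n := Nat.cast_nonneg _
  push_cast at h
  nlinarith

theorem length_bits_natAbs_le (Δ : ℤ) :
    (Δ.natAbs.bits.length : ℝ) ≤ 3 * Real.log (|(Δ : ℝ)| + 1) := by
  rw [Nat.size_eq_bits_len]
  by_cases h : Δ.natAbs = 0
  · simp [Int.natAbs_eq_zero.1 h]
  · have e : ((Δ.natAbs : ℕ) : ℝ) = |(Δ : ℝ)| := by rw [Nat.cast_natAbs]; simp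
    have h := natSize_mul_log_two_le (m := Δ.natAbs) (a := (|(Δ : ℝ)| + 1) ^ 2) h
      (by rw [e]; nlinarith [abs_nonneg (Δ : ℝ)])
    rw [Real.log_pow] at h
    have := two_thirds_lt_log_two
    have h0 : (0 : ℝ) ≤ Nat.size Δ.natAbs := Nat.cast_nonneg _
    push_cast at h
    nlinarith

namespace WeightedDigraph

variable {V : Type*} [Fintype V]

theorem capBound_le (G : WeightedDigraph V) :
    G.capBound ≤ (Fintype.card V ^ 2 + 1) * G.maxWeight := by
  have h1 : ∑ e ∈ G.edges, G.weight e ≤ G.edges.card • G.maxWeight :=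
    Finset.sum_le_card_nsmul _ _ _ fun e he => Finset.le_sup (f := G.weight) he
  have h2 : G.edges.card ≤ Fintype.card V ^ 2 := by
    rw [sq, ← Fintype.card_prod]
    exact Finset.card_le_univ _
  have h3 := Nat.mul_le_mul_right G.maxWeight h2
  rw [smul_eq_mul] at h1
  rw [capBound, add_mul, one_mul]
  omega

theorem natSize_capBound_le (G : WeightedDigraph V) (hV : 2 ≤ Fintype.card V) :
    (Nat.size G.capBound : ℝ)
      ≤ 6 * Real.log (Fintype.card V) + 3 / 2 * Real.log G.maxWeight := by
  have hV' : (2 : ℝ) ≤ Fintype.card V := by exact_mod_cast hV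
  have hn : 0 ≤ Real.log (Fintype.card V) := Real.log_natCast_nonneg _
  have hW : 0 ≤ Real.log G.maxWeight := Real.log_natCast_nonneg _
  by_cases h : G.capBound = 0
  · rw [h, Nat.size_zero]; push_cast; positivity
  have hb := G.capBound_le
  have hW0 : G.maxWeight ≠ 0 := by
    intro h'
    rw [h', mul_zero] at hb
    omega
  have hW1 : (1 : ℝ) ≤ G.maxWeight := by exact_mod_cast Nat.one_le_iff_ne_zero.2 hW0
  have hb' : (G.capBound : ℝ) ≤ ((Fintype.card V : ℝ) ^ 2 + 1) * G.maxWeight := by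
    exact_mod_cast hb
  have key := natSize_mul_log_two_le (a := (Fintype.card V : ℝ) ^ 4 * G.maxWeight) h (by
    have h4 : (4 : ℝ) ≤ (Fintype.card V : ℝ) ^ 2 := by nlinarith
    have : 2 * ((Fintype.card V : ℝ) ^ 2 + 1) ≤ (Fintype.card V : ℝ) ^ 4 := by nlinarith
    nlinarith)
  rw [Real.log_mul (by positivity) (by positivity), Real.log_pow] at key
  have := two_thirds_lt_log_two
  have h0 : (0 : ℝ) ≤ Nat.size G.capBound := Nat.cast_nonneg _
  push_cast at key
  nlinarith

variable [DecidableEq V]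

/-- The blocks of the label of `v`: the numbers for the cuts that a queried edge does not leave,
with headers marking `s` as a tail and `t` as a head, and the blocks of the position of `v`. -/
noncomputable def labelBlocks (G : WeightedDigraph V) (s t : V) (pos : V → ℕ) (μ : ℕ → ℕ → ℕ)
    (v : V) : List Block :=
  ⟨decide (v = s), decide (v = t), G.avoidCap s t v, G.containCap s t v⟩ ::
    lineBlocks μ G.capBound (pos v) (Nat.size (Fintype.card V))

/-- The symbols of the label of `v`, in the order in which they are scanned. -/
noncomputable def labelSymbols (G : WeightedDigraph V) (s t : V) (pos : V → ℕ) (μ : ℕ → ℕ → ℕ)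
    (v : V) : List (Bool × Bool × Bool) :=
  (G.labelBlocks s t pos μ v).flatMap (Block.symbols (Nat.size G.capBound))

theorem length_labelSymbols (G : WeightedDigraph V) (s t : V) (pos : V → ℕ) (μ : ℕ → ℕ → ℕ)
    (v : V) : (G.labelSymbols s t pos μ v).length
      = (Nat.size G.capBound + 1) * (Nat.size (Fintype.card V) + 2) := by
  rw [labelSymbols, length_flatMap_symbols, labelBlocks, List.length_cons, length_lineBlocks]

theorem length_labelSymbols_le (G : WeightedDigraph V) (s t : V) (pos : V → ℕ) (μ : ℕ → ℕ → ℕ)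
    (v : V) (hV : 2 ≤ Fintype.card V) : ((G.labelSymbols s t pos μ v).length : ℝ)
      ≤ 48 * (Real.log (Fintype.card V) ^ 2
        + Real.log (Fintype.card V) * Real.log G.maxWeight) := by
  have hV' : (2 : ℝ) ≤ Fintype.card V := by exact_mod_cast hV
  have h2 := Real.log_le_log (by norm_num) hV'
  have h3 := two_thirds_lt_log_two
  have hW : 0 ≤ Real.log G.maxWeight := Real.log_natCast_nonneg _
  have h4 := G.natSize_capBound_le hV
  have h5 := natSize_le_log hV
  rw [length_labelSymbols]
  push_cast
  calc ((Nat.size G.capBound : ℝ) + 1) * (Nat.size (Fintype.card V) + 2)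
      ≤ (8 * Real.log (Fintype.card V) + 2 * Real.log G.maxWeight)
          * (6 * Real.log (Fintype.card V)) := by
        apply mul_le_mul <;> linarith
    _ ≤ _ := by nlinarith [mul_nonneg (by linarith : 0 ≤ Real.log (Fintype.card V)) hW]

end WeightedDigraph

theorem theorem1p11 :
    ∃ (M : Turing.TM2ComputableAux (Option Bool) Bool) (C : ℝ) (k : ℕ),
      ∀ (V : Type*) [Fintype V] [DecidableEq V] (G : WeightedDigraph V) (s t : V), s ≠ t →
        ∃ label : V → List Bool,
          (∀ v : V, ((label v).length : ℝ) ≤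
            C * (Real.log (Fintype.card V) ^ 2
              + Real.log (Fintype.card V) * Real.log G.maxWeight)) ∧
          ∀ x y : V, (x, y) ∈ G.edges → ∀ Δ : ℤ, -(G.weight (x, y) : ℤ) ≤ Δ →
            HaltsWithin M (queryInput (label x) (label y) Δ)
              (minCutCapacity G.edges (G.changedWeight (x, y) Δ) s t).bits
              (C * ((Real.log (Fintype.card V) + Real.log G.maxWeight) ^ k
                + Real.log (|(Δ : ℝ)| + 1))) := by
  refine ⟨queryMachine, 1000, 2, fun V _ _ G s t hst => ?_⟩
  have hV : 2 ≤ Fintype.card V := Fintype.one_lt_card_iff.2 ⟨s, t, hst⟩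
  have hV' : (2 : ℝ) ≤ Fintype.card V := by exact_mod_cast hV
  have hlog := two_thirds_lt_log_two.trans_le (Real.log_le_log (by norm_num) hV')
  have hW : 0 ≤ Real.log G.maxWeight := Real.log_natCast_nonneg _
  have hnW := mul_nonneg (by linarith : 0 ≤ Real.log (Fintype.card V)) hW
  obtain ⟨pos, μ, hpos, hμ, hadd, hdist, hvital⟩ := G.exists_line s t
  have hlen := fun v => G.length_labelSymbols_le s t pos μ v hV
  refine ⟨fun v => (flatten₃ (G.labelSymbols s t pos μ v)).reverse, fun v => ?_, ?_⟩
  · rw [List.length_reverse, length_flatten₃]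
    have := hlen v
    push_cast
    nlinarith [sq_nonneg (Real.log (Fintype.card V))]
  intro x y he Δ hΔ
  have hfits : ∀ v, ∀ b ∈ G.labelBlocks s t pos μ v, b.Fits (Nat.size G.capBound) := by
    intro v b hb
    rcases List.mem_cons.1 hb with rfl | hb
    · exact ⟨(WeightedDigraph.avoidCap_le_capBound hst v).trans_lt (Nat.lt_size_self _),
        (WeightedDigraph.containCap_le_capBound hst v).trans_lt (Nat.lt_size_self _)⟩
    · exact fits_lineBlocks μ _ _ _ _ hμ (Nat.lt_size_self _) b hb
  obtain ⟨S, hS, hinf, hnear, hnearl, hfar, hfarl⟩ := scan_blocks (Nat.size G.capBound) _ _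
    (fits_zipWith_merge _ _ _ (hfits x) (hfits y))
    (exists_hdr_ne_lineBlocks μ G.capBound (pos x) (pos y) (Nat.size (Fintype.card V)))
  have hsmall : ∀ v, pos v / 2 ^ Nat.size (Fintype.card V) = 0 := fun v =>
    Nat.div_eq_of_lt ((hpos v).trans (Nat.lt_size_self _))
  rw [firstDiff_lineBlocks μ G.capBound (pos x) (pos y) _
    (fun m h1 h2 => hadd _ m _ h1 h2 (hpos y)) (by rw [hsmall, hsmall])] at hnear
  dsimp only [Block.merge] at hinf hfar
  obtain ⟨h0, hmin⟩ := WeightedDigraph.minCutCapacity_changedWeight hst he hΔ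
    (near := bitsVal S.near)
    (by
      rw [hnear]
      split_ifs with h
      exacts [hdist x y h, Or.inl rfl])
    (fun hv C hC => by
      rw [hnear, if_pos (hvital x y hv).1]
      exact (hvital x y hv).2 C hC)
  rw [hmin, ← hinf, ← hfar]
  have hle : Nat.size G.capBound ≤ (G.labelSymbols s t pos μ x).length := by
    rw [WeightedDigraph.length_labelSymbols]
    nlinarith
  refine queryMachine_run _ _ (by simp only [WeightedDigraph.length_labelSymbols])
    Δ S ?_ (by omega) (by omega) h0 _ ?_
  · rw [WeightedDigraph.labelSymbols, WeightedDigraph.labelSymbols, mergeSymbols_flatMap]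
    exact hS
  · have h1 := hlen x
    have h2 := length_bits_natAbs_le Δ
    nlinarith [sq_nonneg (Real.log G.maxWeight)]
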